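/- Let $\Lambda\subset\mathbb{R}^2$ be the lattice generated over $\mathbb{Z}$ by a basis of $\mathbb{R}^2$, let $d(\Lambda)$ be its covolume (the area of the parallelogram spanned by a $\mathbb{Z}$-basis of $\Lambda$), and let $\pi:\mathbb{R}^2\to\mathbb{R}^2/\Lambda$ be the quotient map onto the flat torus. An axis-aligned rectangular tiling $T$ of $\mathbb{R}^2/\Lambda$ is a finite family of rectangles $R_i=[a_i,b_i]\times[c_i,d_i]\subset\mathbb{R}^2$ with $a_i<b_i$ and $c_i<d_i$ $(1\le i\le k)$ such that $\pi$ is injective on the interior of each $R_i$, the images under $\pi$ of the interiors of the $R_i$ are pairwise disjoint, and $\bigcup_{i}\pi(R_i)=\mathbb{R}^2/\Lambda$. Its length is half of the total perimeter, $m(T)=\sum_{i=1}^k[(b_i-a_i)+(d_i-c_i)]$. For $u=(x,y)\in\mathbb{R}^2$ put $\|u\|_1=|x|+|y|$, and let $Q_1=\{(x,y):xy\ge 0\}$ and $Q_2=\{(x,y):xy<0\}$. Call $\{u,v\}$ a quadrant basis of $\Lambda$ if $u$ is of minimum $\ell^1$-norm in $(\Lambda\cap Q_1)\setminus\{0\}$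 and $v$ is of minimum $\ell^1$-norm in $\Lambda\cap Q_2$. If $\Lambda$ contains a vector $(a,0)$ with $a\neq 0$, let $d_x$ be the least positive number with $(d_x,0)\in\Lambda$ and put $m_x(\Lambda)=d_x+d(\Lambda)/d_x$; otherwise put $m_x(\Lambda)=\infty$. Likewise, if $\Lambda$ contains a vector $(0,b)$ with $b\neq 0$, let $d_y$ be the least positive number with $(0,d_y)\in\Lambda$ and put $m_y(\Lambda)=d_y+d(\Lambda)/d_y$; otherwise put $m_y(\Lambda)=\infty$. Theorem. The lattice $\Lambda$ has a quadrant basis, and for every quadrant basis $\{u,v\}$ of $\Lambda$, the minimum of $m(T)$ over all axis-aligned rectangular tilings $T$ of $\mathbb{R}^2/\Lambda$ exists and equals $$\min\{\|u\|_1+\|v\|_1,\; m_x(\Lambda),\; m_y(\Lambda)\}.$$ Moreover, this minimum is attained by a tiling with exactly one rectangle or by a tiling with exactly two rectangles. -/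

import Mathlib

namespace FlatTorus

/-- The quotient map from the plane onto the flat torus `ℝ² / Λ`. -/
abbrev proj (Λ : Submodule ℤ (ℝ × ℝ)) : ℝ × ℝ → (ℝ × ℝ) ⧸ Λ := fun p => Λ.mkQ p

/-- `Λ` is the lattice generated over `ℤ` by some basis of the real plane. -/
def IsPlaneLattice (Λ : Submodule ℤ (ℝ × ℝ)) : Prop :=
  ∃ e : Module.Basis (Fin 2) ℝ (ℝ × ℝ), Λ = Submodule.span ℤ (Set.range e)

/-- The `ℓ¹`-norm on the plane (Mathlib's norm on `ℝ × ℝ` is the sup norm). -/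
def l1norm (p : ℝ × ℝ) : ℝ := |p.1| + |p.2|

/-- The closed "quadrant" `x y ≥ 0`. -/
def Q1 : Set (ℝ × ℝ) := {p | 0 ≤ p.1 * p.2}

/-- The open "quadrant" `x y < 0`. -/
def Q2 : Set (ℝ × ℝ) := {p | p.1 * p.2 < 0}

/-- `u` has minimum `ℓ¹`-norm in `(Λ ∩ Q₁) \ {0}` and `v` has minimum `ℓ¹`-norm in `Λ ∩ Q₂`. -/
structure IsQuadrantBasis (Λ : Submodule ℤ (ℝ × ℝ)) (u v : ℝ × ℝ) : Prop where
  u_mem : u ∈ ((Λ : Set (ℝ × ℝ)) ∩ Q1) \ {0}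
  u_min : ∀ w ∈ ((Λ : Set (ℝ × ℝ)) ∩ Q1) \ {0}, l1norm u ≤ l1norm w
  v_mem : v ∈ (Λ : Set (ℝ × ℝ)) ∩ Q2
  v_min : ∀ w ∈ (Λ : Set (ℝ × ℝ)) ∩ Q2, l1norm v ≤ l1norm w

/-- The least positive `t` with `(t, 0) ∈ Λ`, for a lattice `Λ` containing a nonzero horizontal
vector (the infimum is then attained, a lattice being discrete). -/
noncomputable def dx (Λ : Submodule ℤ (ℝ × ℝ)) : ℝ := sInf {t : ℝ | 0 < t ∧ (t, (0 : ℝ)) ∈ Λ}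

/-- The least positive `t` with `(0, t) ∈ Λ`, for a lattice `Λ` containing a nonzero vertical
vector. -/
noncomputable def dy (Λ : Submodule ℤ (ℝ × ℝ)) : ℝ := sInf {t : ℝ | 0 < t ∧ ((0 : ℝ), t) ∈ Λ}

open Classical in
/-- `d_x + d(Λ) / d_x` if `Λ` contains a nonzero horizontal vector, and `∞` otherwise; `d(Λ)` is
the covolume of `Λ` with respect to Lebesgue measure on the plane. -/
noncomputable def mx (Λ : Submodule ℤ (ℝ × ℝ)) : EReal :=
  if ∃ a : ℝ, a ≠ 0 ∧ (a, (0 : ℝ)) ∈ Λ then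
    ((dx Λ + ZLattice.covolume Λ MeasureTheory.volume / dx Λ : ℝ) : EReal)
  else ⊤

open Classical in
/-- `d_y + d(Λ) / d_y` if `Λ` contains a nonzero vertical vector, and `∞` otherwise. -/
noncomputable def my (Λ : Submodule ℤ (ℝ × ℝ)) : EReal :=
  if ∃ b : ℝ, b ≠ 0 ∧ ((0 : ℝ), b) ∈ Λ then
    ((dy Λ + ZLattice.covolume Λ MeasureTheory.volume / dy Λ : ℝ) : EReal)
  else ⊤

/-- An axis-aligned (nondegenerate) rectangle `[a, b] × [c, d]` in the plane. -/
structure Rect where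
  a : ℝ
  b : ℝ
  c : ℝ
  d : ℝ
  hab : a < b
  hcd : c < d

/-- The closed rectangle as a set of points. -/
def Rect.closed (R : Rect) : Set (ℝ × ℝ) := Set.Icc R.a R.b ×ˢ Set.Icc R.c R.d

/-- The interior of the rectangle. -/
def Rect.inner (R : Rect) : Set (ℝ × ℝ) := Set.Ioo R.a R.b ×ˢ Set.Ioo R.c R.d

/-- The perimeter of the rectangle. -/
def Rect.perimeter (R : Rect) : ℝ := 2 * ((R.b - R.a) + (R.d - R.c))

/-- An axis-aligned rectangular tiling of the flat torus `ℝ² / Λ` by `k` rectangles. -/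
structure RectTiling (Λ : Submodule ℤ (ℝ × ℝ)) where
  k : ℕ
  rect : Fin k → Rect
  injOn : ∀ i, Set.InjOn (proj Λ) (rect i).inner
  disjoint : ∀ i j, i ≠ j → Disjoint (proj Λ '' (rect i).inner) (proj Λ '' (rect j).inner)
  cover : ⋃ i, proj Λ '' (rect i).closed = Set.univ

/-- The length of a tiling: half of the sum of the perimeters of its rectangles. -/
noncomputable def RectTiling.length {Λ : Submodule ℤ (ℝ × ℝ)} (T : RectTiling Λ) : ℝ :=
  (∑ i, (T.rect i).perimeter) / 2

end FlatTorus

/-!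
The lower bound is proved by induction on the number of tiles, for the periodic tiling of the plane
made of all translates of the rectangles (`PlaneTiling`).

* If the top side of a tile `t` ends at both of its corners, the tiles above `t` fit exactly on top
  of `t`. Either `t` itself is one of them; then `t` closes up around the torus, its height is
  `d_y`, no other tile is higher, and comparing areas gives `m_y(Λ) ≤ m(T)`. Or `t` can grow upwards
  at the expense of the tiles above it until one of these disappears; this does not increase the
  length (`PlaneTiling.mem_or_exists_smaller`). The other three sides are treated by turning the
  plane by quarter turns.
* Otherwise each of the four sides of every tile continues beyond one of its ends. At a corner at
  most one of the two sides continues, so the four sides of a tile continue in the same sense of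
  rotation and there are only two types of tiles (`IsPinwheel`). The top side of a tile of the
  first type is continued to the left by a tile of the second type, the right side of which is
  continued downwards by a tile of the first type (`exists_step`). Iterating, one gets a staircase
  which closes up on the torus. It yields a lattice vector in the open first quadrant whose
  `ℓ¹`-norm is at most the total width of the tiles of the first type plus the total height of the
  tiles of the second type (`exists_mem_of_isPinwheel`). Turned by a quarter turn, the same argument
  gives a vector in `Q₂`, bounded by the remaining heights and widths. Together the two norms are at
  most `m(T)`.

For the upper bound, a quadrant basis `(p, q)`, `(-r, s)` generates the lattice
(`IsQuadrantBasis.exists_int`), because of the minimality of its vectors, tested at the differences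
between a lattice point in the fundamental parallelogram and the four vertices. If `p` and `q` are
positive, an L-shape made of an `r × q` and a `p × s` rectangle is a fundamental domain
(`planeTiling_lShape`); if one of them vanishes, `m_x(Λ)` or `m_y(Λ)` is smaller than the sum of the
norms. These two quantities are the lengths of tilings by a single rectangle
(`exists_planeTiling_mx`).
-/

namespace FlatTorus

/-! ### Lattices and quadrant bases -/

/-- Every bounded region of the plane contains only finitely many points of `Λ`. -/
def LocallyFinite (Λ : Submodule ℤ (ℝ × ℝ)) : Prop :=
  ∀ B : ℝ, {l : ℝ × ℝ | l ∈ Λ ∧ |l.1| ≤ B ∧ |l.2| ≤ B}.Finite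

theorem IsPlaneLattice.locallyFinite {Λ : Submodule ℤ (ℝ × ℝ)} (h : IsPlaneLattice Λ) :
    LocallyFinite Λ := by
  obtain ⟨e, rfl⟩ := h
  intro B
  refine (ZSpan.setFinite_inter e
    (Metric.isBounded_closedBall (x := (0 : ℝ × ℝ)) (r := B))).subset ?_
  rintro l ⟨hl, h1, h2⟩
  refine ⟨?_, hl⟩
  rw [mem_closedBall_zero_iff, Prod.norm_def, Real.norm_eq_abs, Real.norm_eq_abs]
  exact max_le h1 h2

theorem IsPlaneLattice.exists_near {Λ : Submodule ℤ (ℝ × ℝ)} (h : IsPlaneLattice Λ) :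
    ∃ C : ℝ, ∀ z : ℝ × ℝ, ∃ l ∈ Λ, |z.1 - l.1| ≤ C ∧ |z.2 - l.2| ≤ C := by
  obtain ⟨e, rfl⟩ := h
  refine ⟨∑ i, ‖e i‖, fun z => ⟨ZSpan.floor e z, (ZSpan.floor e z).2, ?_⟩⟩
  have h := ZSpan.norm_fract_le e z
  rw [ZSpan.fract_apply, Prod.norm_def, max_le_iff] at h
  exact h

/-- A function that bounds the coordinates has a minimum on every nonempty set of lattice points. -/
theorem LocallyFinite.exists_min {Λ : Submodule ℤ (ℝ × ℝ)} (h : LocallyFinite Λ)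
    {S : Set (ℝ × ℝ)} (hS : ∀ l ∈ S, l ∈ Λ) (hne : S.Nonempty) (f : ℝ × ℝ → ℝ)
    (hf : ∀ B : ℝ, ∃ B' : ℝ, ∀ l ∈ S, f l ≤ B → |l.1| ≤ B' ∧ |l.2| ≤ B') :
    ∃ l ∈ S, ∀ w ∈ S, f l ≤ f w := by
  obtain ⟨w₀, hw₀⟩ := hne
  obtain ⟨B', hB'⟩ := hf (f w₀)
  have hfin : {l | l ∈ S ∧ f l ≤ f w₀}.Finite :=
    (h B').subset fun l hl => ⟨hS l hl.1, hB' l hl.1 hl.2⟩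
  obtain ⟨l, hl, hmin⟩ := Set.exists_min_image _ f hfin ⟨w₀, hw₀, le_rfl⟩
  refine ⟨l, hl.1, fun w hw => ?_⟩
  rcases le_total (f w) (f w₀) with h' | h'
  · exact hmin w ⟨hw, h'⟩
  · exact hl.2.trans h'

theorem abs_le_of_l1norm_le {B : ℝ} {l : ℝ × ℝ} (h : l1norm l ≤ B) : |l.1| ≤ B ∧ |l.2| ≤ B := by
  unfold l1norm at h
  constructor <;> linarith [abs_nonneg l.1, abs_nonneg l.2]

theorem exists_isQuadrantBasis {Λ : Submodule ℤ (ℝ × ℝ)} (hΛ : IsPlaneLattice Λ) :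
    ∃ u v : ℝ × ℝ, IsQuadrantBasis Λ u v := by
  obtain ⟨C, hC⟩ := hΛ.exists_near
  have hC0 : 0 ≤ C := (abs_nonneg _).trans (hC 0).choose_spec.2.1
  obtain ⟨x, hx, hx1, hx2⟩ := hC (C + 1, C + 1)
  obtain ⟨y, hy, hy1, hy2⟩ := hC (-(C + 1), C + 1)
  rw [abs_le] at hx1 hx2 hy1 hy2
  simp only at hx1 hx2 hy1 hy2
  obtain ⟨⟨_, hx1⟩, _, hx2⟩ := And.intro hx1 hx2
  obtain ⟨⟨hy1, _⟩, _, hy2⟩ := And.intro hy1 hy2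
  obtain ⟨u, hu, hu'⟩ := hΛ.locallyFinite.exists_min
    (S := ((Λ : Set (ℝ × ℝ)) ∩ Q1) \ {0}) (fun l hl => hl.1.1)
    ⟨x, ⟨hx, show 0 ≤ x.1 * x.2 from mul_nonneg (by linarith) (by linarith)⟩, fun h => by
      rw [Set.mem_singleton_iff] at h
      rw [h] at hx1
      simp only [Prod.fst_zero] at hx1
      linarith⟩ l1norm (fun B => ⟨B, fun l _ h => abs_le_of_l1norm_le h⟩)
  obtain ⟨v, hv, hv'⟩ := hΛ.locallyFinite.exists_min
    (S := (Λ : Set (ℝ × ℝ)) ∩ Q2) (fun l hl => hl.1)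
    ⟨y, hy, show y.1 * y.2 < 0 from mul_neg_of_neg_of_pos (by linarith) (by linarith)⟩ l1norm
    (fun B => ⟨B, fun l _ h => abs_le_of_l1norm_le h⟩)
  exact ⟨u, v, hu, hu', hv, hv'⟩

theorem IsQuadrantBasis.neg_left {Λ : Submodule ℤ (ℝ × ℝ)} {u v : ℝ × ℝ}
    (h : IsQuadrantBasis Λ u v) : IsQuadrantBasis Λ (-u) v where
  u_mem := ⟨⟨Λ.neg_mem h.u_mem.1.1, by simpa [Q1] using h.u_mem.1.2⟩,
    by simpa using h.u_mem.2⟩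
  u_min w hw := by simpa [l1norm] using h.u_min w hw
  v_mem := h.v_mem
  v_min := h.v_min

theorem IsQuadrantBasis.neg_right {Λ : Submodule ℤ (ℝ × ℝ)} {u v : ℝ × ℝ}
    (h : IsQuadrantBasis Λ u v) : IsQuadrantBasis Λ u (-v) where
  u_mem := h.u_mem
  u_min := h.u_min
  v_mem := ⟨Λ.neg_mem h.v_mem.1, by simpa [Q2] using h.v_mem.2⟩
  v_min w hw := by simpa [l1norm] using h.v_min w hw

/-- A quadrant basis can be reflected in the origin, vector by vector, so that `u` lies in the
closed first quadrant and `v` in the open second one. -/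
theorem IsQuadrantBasis.exists_normalized {Λ : Submodule ℤ (ℝ × ℝ)} {u v : ℝ × ℝ}
    (h : IsQuadrantBasis Λ u v) : ∃ p q r s : ℝ, IsQuadrantBasis Λ (p, q) (-r, s) ∧
      0 ≤ p ∧ 0 ≤ q ∧ 0 < p + q ∧ 0 < r ∧ 0 < s ∧ l1norm u = p + q ∧ l1norm v = r + s := by
  have hu : ∃ p q : ℝ, IsQuadrantBasis Λ (p, q) v ∧ 0 ≤ p ∧ 0 ≤ q ∧ l1norm u = p + q := by
    have hm : 0 ≤ u.1 * u.2 := h.u_mem.1.2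
    rcases mul_nonneg_iff.1 hm with ⟨h1, h2⟩ | ⟨h1, h2⟩
    · exact ⟨u.1, u.2, h, h1, h2, by simp [l1norm, abs_of_nonneg, h1, h2]⟩
    · exact ⟨-u.1, -u.2, h.neg_left, by linarith, by linarith,
        by simp [l1norm, abs_of_nonpos, h1, h2]⟩
  obtain ⟨p, q, h', hp, hq, hu⟩ := hu
  have hpq : 0 < p + q := by
    rcases (add_nonneg hp hq).lt_or_eq with h0 | h0
    · exact h0
    · exact absurd (by rw [Set.mem_singleton_iff, Prod.mk_eq_zero]; constructor <;> linarith)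
        h'.u_mem.2
  have hm : v.1 * v.2 < 0 := h.v_mem.2
  rcases mul_neg_iff.1 hm with ⟨h1, h2⟩ | ⟨h1, h2⟩
  · refine ⟨p, q, v.1, -v.2, h'.neg_right, hp, hq, hpq, h1, by linarith, hu, ?_⟩
    simp [l1norm, abs_of_pos h1, abs_of_neg h2]
  · refine ⟨p, q, -v.1, v.2, by rw [neg_neg]; exact h', hp, hq, hpq, by linarith, h2, hu, ?_⟩
    simp [l1norm, abs_of_pos h2, abs_of_neg h1]

/-- The minimality of a quadrant basis, in terms of the signs of the coordinates. -/
theorem IsQuadrantBasis.le_or_le {Λ : Submodule ℤ (ℝ × ℝ)} {p q r s : ℝ}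
    (h : IsQuadrantBasis Λ (p, q) (-r, s)) (hp : 0 ≤ p) (hq : 0 ≤ q) (hr : 0 < r) (hs : 0 < s)
    {x y : ℝ} (hw : (x, y) ∈ Λ) (h0 : ¬(x = 0 ∧ y = 0)) :
    0 ≤ x * y ∧ p + q ≤ |x| + |y| ∨ x * y < 0 ∧ r + s ≤ |x| + |y| := by
  rcases le_or_gt 0 (x * y) with hxy | hxy
  · have := h.u_min (x, y) ⟨⟨hw, hxy⟩, fun h => h0 (by
      rwa [Set.mem_singleton_iff, Prod.mk_eq_zero] at h)⟩
    simp only [l1norm, abs_of_nonneg hp, abs_of_nonneg hq] at this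
    exact Or.inl ⟨hxy, this⟩
  · have := h.v_min (x, y) ⟨hw, hxy⟩
    simp only [l1norm, abs_neg, abs_of_pos hr, abs_of_pos hs] at this
    exact Or.inr ⟨hxy, this⟩

/-- The minimality of a quadrant basis, for lattice points of the right half-plane. -/
theorem IsQuadrantBasis.le_or_le_of_fst {Λ : Submodule ℤ (ℝ × ℝ)} {p q r s : ℝ}
    (h : IsQuadrantBasis Λ (p, q) (-r, s)) (hp : 0 ≤ p) (hq : 0 ≤ q) (hr : 0 < r) (hs : 0 < s)
    {x y : ℝ} (hw : (x, y) ∈ Λ) (h0 : 0 < x ∨ x = 0 ∧ 0 < y) :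
    p + q ≤ x + y ∨ r + s ≤ x - y := by
  have hx : 0 ≤ x := by rcases h0 with h0 | h0 <;> linarith
  rcases h.le_or_le hp hq hr hs hw
    (fun h => by rcases h0 with h0 | h0 <;> linarith [h.1, h.2]) with ⟨h1, h2⟩ | ⟨h1, h2⟩
  · have hy : 0 ≤ y := by
      rcases h0 with h0 | h0
      · exact nonneg_of_mul_nonneg_right h1 h0
      · exact h0.2.le
    rw [abs_of_nonneg hx, abs_of_nonneg hy] at h2
    exact Or.inl h2
  · have hy : y < 0 := neg_of_mul_neg_right h1 hx
    rw [abs_of_nonneg hx, abs_of_neg hy] at h2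
    exact Or.inr (by linarith)

/-- The minimality of a quadrant basis, for lattice points of the upper half-plane. -/
theorem IsQuadrantBasis.le_or_le_of_snd {Λ : Submodule ℤ (ℝ × ℝ)} {p q r s : ℝ}
    (h : IsQuadrantBasis Λ (p, q) (-r, s)) (hp : 0 ≤ p) (hq : 0 ≤ q) (hr : 0 < r) (hs : 0 < s)
    {x y : ℝ} (hw : (x, y) ∈ Λ) (h0 : 0 < y ∨ y = 0 ∧ 0 < x) :
    p + q ≤ x + y ∨ r + s ≤ y - x := by
  have hy : 0 ≤ y := by rcases h0 with h0 | h0 <;> linarith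
  rcases h.le_or_le hp hq hr hs hw
    (fun h => by rcases h0 with h0 | h0 <;> linarith [h.1, h.2]) with ⟨h1, h2⟩ | ⟨h1, h2⟩
  · have hx : 0 ≤ x := by
      rcases h0 with h0 | h0
      · exact nonneg_of_mul_nonneg_left h1 h0
      · exact h0.2.le
    rw [abs_of_nonneg hx, abs_of_nonneg hy] at h2
    exact Or.inl h2
  · have hx : x < 0 := neg_of_mul_neg_left h1 hy
    rw [abs_of_neg hx, abs_of_nonneg hy] at h2
    exact Or.inr (by linarith)

/-- The four vertices of a fundamental parallelogram, seen from a lattice point inside it, cannot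
all be as far away as the minimality of a quadrant basis demands. In the coordinates of a quadrant
basis `(p, q)`, `(-r, s)` the variables are `U = p + q`, `V = r + s`, `D = s - r`, `E = q - p`. -/
theorem parallelogram_contradiction {U V D E α β : ℝ} (hU : 0 < U) (hV : 0 < V) (hD : |D| < V)
    (hE : |E| ≤ U) (hα : 0 ≤ α) (hα' : α < 1) (hβ : 0 ≤ β) (hβ' : β < 1) (h0 : α ≠ 0 ∨ β ≠ 0)
    (h1 : U ≤ α * U + β * D ∨ V ≤ α * E + β * V)
    (h2 : U ≤ α * U - (1 - β) * D ∨ V ≤ (1 - β) * V - α * E)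
    (h3 : U ≤ (1 - α) * U - β * D ∨ V ≤ β * V - (1 - α) * E)
    (h4 : U ≤ (1 - α) * U + (1 - β) * D ∨ V ≤ (1 - α) * E + (1 - β) * V) : False := by
  rw [abs_lt] at hD
  rw [abs_le] at hE
  obtain ⟨hD1, hD2⟩ := hD
  obtain ⟨hE1, hE2⟩ := hE
  have e1 : 0 < (1 - α) * U := mul_pos (by linarith) hU
  have e2 : 0 < (1 - β) * V := mul_pos (by linarith) hV
  rcases le_or_gt 0 D with hD0 | hD0
  · have f1 : 0 ≤ β * D := mul_nonneg hβ hD0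
    have f2 : 0 ≤ (1 - β) * D := mul_nonneg (by linarith) hD0
    have h2 : V ≤ (1 - β) * V - α * E := h2.resolve_left (by linarith)
    have hα0 : 0 < α := by
      rcases hα.lt_or_eq with h | rfl
      · exact h
      · have : 0 < β := lt_of_le_of_ne hβ (h0.resolve_left (by simp)).symm
        nlinarith [mul_pos this hV]
    have e3 : 0 < α * U := mul_pos hα0 hU
    have h3 : V ≤ β * V - (1 - α) * E := h3.resolve_left (by linarith)
    have hE0 : E < 0 := by
      by_contra! h
      linarith [mul_nonneg (by linarith : 0 ≤ 1 - α) h]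
    have h1 : U ≤ α * U + β * D := h1.resolve_right (by linarith [mul_pos hα0 (neg_pos.2 hE0)])
    have h4 := h4.resolve_right (by
      linarith [mul_pos (by linarith : 0 < 1 - α) (neg_pos.2 hE0), mul_nonneg hβ hV.le])
    linarith
  · have f1 : β * D ≤ 0 := mul_nonpos_of_nonneg_of_nonpos hβ hD0.le
    have f2 : (1 - β) * D < 0 := mul_neg_of_pos_of_neg (by linarith) hD0
    have h1 := h1.resolve_left (by linarith)
    have hα0 : 0 < α := by
      rcases hα.lt_or_eq with h | rfl
      · exact h
      · linarith
    have e3 : 0 < α * U := mul_pos hα0 hU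
    have hE0 : 0 < E := pos_of_mul_pos_right (a := α) (by linarith) hα
    have h4 := h4.resolve_left (by linarith)
    have h2 := h2.resolve_right (by linarith [mul_pos hα0 hE0, mul_nonneg hβ hV.le])
    have h3 := h3.resolve_right (by linarith [mul_pos (by linarith : 0 < 1 - α) hE0])
    linarith

/-- A quadrant basis generates the lattice. -/
theorem IsQuadrantBasis.exists_int {Λ : Submodule ℤ (ℝ × ℝ)} {p q r s : ℝ}
    (h : IsQuadrantBasis Λ (p, q) (-r, s)) (hp : 0 ≤ p) (hq : 0 ≤ q) (hpq : 0 < p + q)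
    (hr : 0 < r) (hs : 0 < s) {x y : ℝ} (hw : (x, y) ∈ Λ) :
    ∃ m n : ℤ, x = m * p - n * r ∧ y = m * q + n * s := by
  have hdet : 0 < p * s + q * r := by
    rcases hp.lt_or_eq with hp' | hp'
    · exact add_pos_of_pos_of_nonneg (mul_pos hp' hs) (mul_nonneg hq hr.le)
    · exact add_pos_of_nonneg_of_pos (mul_nonneg hp hs.le) (mul_pos (by linarith) hr)
  -- the coordinates of the point in the basis, by Cramer's rule
  set A := (x * s + y * r) / (p * s + q * r) with hA
  set B := (p * y - q * x) / (p * s + q * r) with hB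
  have hx : x = A * p - B * r := by
    rw [hA, hB, div_mul_eq_mul_div, div_mul_eq_mul_div, ← sub_div, eq_div_iff hdet.ne']
    ring
  have hy : y = A * q + B * s := by
    rw [hA, hB, div_mul_eq_mul_div, div_mul_eq_mul_div, ← add_div, eq_div_iff hdet.ne']
    ring
  have key : ∀ m n : ℤ, ((A - m) * p - (B - n) * r, (A - m) * q + (B - n) * s) ∈ Λ := by
    intro m n
    have := Λ.sub_mem (Λ.sub_mem hw (Λ.smul_mem m h.u_mem.1.1)) (Λ.smul_mem n h.v_mem.1)
    convert this using 1
    rw [hx, hy]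
    ext <;> simp <;> ring
  by_cases h0 : Int.fract A = 0 ∧ Int.fract B = 0
  · refine ⟨⌊A⌋, ⌊B⌋, ?_, ?_⟩
    · rw [hx, ← Int.self_sub_fract A, ← Int.self_sub_fract B, h0.1, h0.2, sub_zero, sub_zero]
    · rw [hy, ← Int.self_sub_fract A, ← Int.self_sub_fract B, h0.1, h0.2, sub_zero, sub_zero]
  exfalso
  have k1 := key ⌊A⌋ ⌊B⌋
  have k2 := key ⌊A⌋ (⌊B⌋ + 1)
  have k3 := Λ.neg_mem (key (⌊A⌋ + 1) ⌊B⌋)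
  have k4 := Λ.neg_mem (key (⌊A⌋ + 1) (⌊B⌋ + 1))
  push_cast at k1 k2 k3 k4
  have eA : A = ⌊A⌋ + Int.fract A := (Int.floor_add_fract A).symm
  have eB : B = ⌊B⌋ + Int.fract B := (Int.floor_add_fract B).symm
  have hα := Int.fract_nonneg A
  have hα' := Int.fract_lt_one A
  have hβ := Int.fract_nonneg B
  have hβ' := Int.fract_lt_one B
  set α := Int.fract A
  set β := Int.fract B
  rw [show A - ⌊A⌋ = α by linarith, show B - ⌊B⌋ = β by linarith] at k1
  rw [show A - ⌊A⌋ = α by linarith, show B - (⌊B⌋ + 1) = β - 1 by linarith] at k2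
  rw [show A - (⌊A⌋ + 1) = α - 1 by linarith, show B - ⌊B⌋ = β by linarith, Prod.neg_mk] at k3
  rw [show A - (⌊A⌋ + 1) = α - 1 by linarith, show B - (⌊B⌋ + 1) = β - 1 by linarith,
    Prod.neg_mk] at k4
  have a1 : 0 ≤ α * q := mul_nonneg hα hq
  have a2 : 0 ≤ β * s := mul_nonneg hβ hs.le
  have a3 : 0 ≤ α * p := mul_nonneg hα hp
  have a4 : 0 ≤ β * r := mul_nonneg hβ hr.le
  have a5 : 0 ≤ (1 - α) * q := mul_nonneg (by linarith) hq
  have a6 : 0 < (1 - β) * s := mul_pos (by linarith) hs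
  have a7 : 0 ≤ (1 - α) * p := mul_nonneg (by linarith) hp
  have a8 : 0 < (1 - β) * r := mul_pos (by linarith) hr
  refine parallelogram_contradiction (U := p + q) (V := r + s) (D := s - r) (E := q - p) hpq
    (by linarith) (abs_lt.2 ⟨by linarith, by linarith⟩) (abs_le.2 ⟨by linarith, by linarith⟩)
    hα hα' hβ hβ' (by tauto) ?_ ?_ ?_ ?_
  · refine (h.le_or_le_of_snd hp hq hr hs k1 ?_).imp (fun h => ?_) fun h => ?_
    · rcases hβ.lt_or_eq with hβ0 | hβ0
      · exact Or.inl (add_pos_of_nonneg_of_pos a1 (mul_pos hβ0 hs))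
      · have hα0 : 0 < α := lt_of_le_of_ne hα fun h => h0 ⟨h.symm, hβ0.symm⟩
        rcases hq.lt_or_eq with hq0 | hq0
        · exact Or.inl (add_pos_of_pos_of_nonneg (mul_pos hα0 hq0) a2)
        · right
          rw [← hβ0, ← hq0]
          exact ⟨by ring, by linarith [mul_pos hα0 (by linarith : 0 < p)]⟩
    all_goals linarith
  · refine (h.le_or_le_of_fst hp hq hr hs k2 (Or.inl ?_)).imp (fun h => ?_) fun h => ?_
    all_goals linarith
  · refine (h.le_or_le_of_fst hp hq hr hs k3 ?_).imp (fun h => ?_) fun h => ?_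
    · rcases hβ.lt_or_eq with hβ0 | hβ0
      · left
        linarith [mul_pos hβ0 hr]
      · rcases hp.lt_or_eq with hp0 | hp0
        · left
          linarith [mul_pos (by linarith : 0 < 1 - α) hp0]
        · right
          rw [← hβ0, ← hp0]
          exact ⟨by ring, by linarith [mul_pos (by linarith : 0 < 1 - α) (by linarith : 0 < q)]⟩
    all_goals linarith
  · refine (h.le_or_le_of_snd hp hq hr hs k4 (Or.inl ?_)).imp (fun h => ?_) fun h => ?_
    all_goals linarith

/-! ### Families of rectangles paving the plane -/

/-- The translate of a rectangle by a vector. -/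
def Rect.shift (R : Rect) (l : ℝ × ℝ) : Rect where
  a := R.a + l.1
  b := R.b + l.1
  c := R.c + l.2
  d := R.d + l.2
  hab := by linarith [R.hab]
  hcd := by linarith [R.hcd]

/-- The image of a rectangle under the rotation `(x, y) ↦ (-y, x)` by a quarter turn. -/
def Rect.rot (R : Rect) : Rect where
  a := -R.d
  b := -R.c
  c := R.a
  d := R.b
  hab := by linarith [R.hcd]
  hcd := R.hab

theorem Rect.rot_rot_rot_rot (R : Rect) : R.rot.rot.rot.rot = R := by
  simp [Rect.rot]

/-- The rectangles `r s` have disjoint interiors, and all four corner germs at each point of the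
plane are covered: a half-open field such as `exists_ne` says that some rectangle contains the
points slightly to the north-east of `(x, y)`. -/
structure IsPaving {S : Type*} (r : S → Rect) : Prop where
  disjoint : ∀ s t z, z ∈ (r s).inner → z ∈ (r t).inner → s = t
  exists_ne : ∀ x y : ℝ, ∃ s, (r s).a ≤ x ∧ x < (r s).b ∧ (r s).c ≤ y ∧ y < (r s).d
  exists_nw : ∀ x y : ℝ, ∃ s, (r s).a < x ∧ x ≤ (r s).b ∧ (r s).c ≤ y ∧ y < (r s).d
  exists_sw : ∀ x y : ℝ, ∃ s, (r s).a < x ∧ x ≤ (r s).b ∧ (r s).c < y ∧ y ≤ (r s).d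
  exists_se : ∀ x y : ℝ, ∃ s, (r s).a ≤ x ∧ x < (r s).b ∧ (r s).c < y ∧ y ≤ (r s).d

/-- The family of rectangles turned by a quarter turn. -/
def rotFamily {S : Type*} (r : S → Rect) : S → Rect := fun s => (r s).rot

theorem rotFamily_four {S : Type*} (r : S → Rect) : rotFamily^[4] r = r := by
  funext s
  exact (r s).rot_rot_rot_rot

theorem rotFamily_iterate_comp {S S' : Type*} (r : S → Rect) (e : S' → S) (k : ℕ) :
    rotFamily^[k] (r ∘ e) = rotFamily^[k] r ∘ e := by
  induction k with
  | zero => rfl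
  | succ k ih =>
    rw [Function.iterate_succ_apply', Function.iterate_succ_apply', ih]
    rfl

theorem rotFamily_iterate_four_mul {S : Type*} (r : S → Rect) (k : ℕ) :
    rotFamily^[4 * k] r = r := by
  rw [Function.iterate_mul]
  exact Function.iterate_fixed (rotFamily_four r) k

theorem IsPaving.rotFamily {S : Type*} {r : S → Rect} (h : IsPaving r) :
    IsPaving (rotFamily r) where
  disjoint s t z hs ht := by
    refine h.disjoint s t (z.2, -z.1) ?_ ?_
    · exact ⟨hs.2, lt_neg.1 hs.1.2, neg_lt.1 hs.1.1⟩
    · exact ⟨ht.2, lt_neg.1 ht.1.2, neg_lt.1 ht.1.1⟩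
  exists_ne x y := by
    obtain ⟨s, h1, h2, h3, h4⟩ := h.exists_se y (-x)
    exact ⟨s, neg_le.1 h4, lt_neg.1 h3, h1, h2⟩
  exists_nw x y := by
    obtain ⟨s, h1, h2, h3, h4⟩ := h.exists_ne y (-x)
    exact ⟨s, neg_lt.1 h4, le_neg.1 h3, h1, h2⟩
  exists_sw x y := by
    obtain ⟨s, h1, h2, h3, h4⟩ := h.exists_nw y (-x)
    exact ⟨s, neg_lt.1 h4, le_neg.1 h3, h1, h2⟩
  exists_se x y := by
    obtain ⟨s, h1, h2, h3, h4⟩ := h.exists_sw y (-x)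
    exact ⟨s, neg_le.1 h4, lt_neg.1 h3, h1, h2⟩

theorem IsPaving.rotFamily_iterate {S : Type*} {r : S → Rect} (h : IsPaving r) (k : ℕ) :
    IsPaving (FlatTorus.rotFamily^[k] r) := by
  induction k with
  | zero => exact h
  | succ k ih => rw [Function.iterate_succ_apply']; exact ih.rotFamily

theorem IsPaving.eq_of_overlap {S : Type*} {r : S → Rect} (h : IsPaving r) {s t : S}
    (h1 : (r s).a < (r t).b) (h2 : (r t).a < (r s).b) (h3 : (r s).c < (r t).d)
    (h4 : (r t).c < (r s).d) : s = t := by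
  obtain ⟨x, hx1, hx2⟩ := exists_between (max_lt (lt_min (r s).hab h1) (lt_min h2 (r t).hab))
  obtain ⟨y, hy1, hy2⟩ := exists_between (max_lt (lt_min (r s).hcd h3) (lt_min h4 (r t).hcd))
  rw [max_lt_iff] at hx1 hy1
  rw [lt_min_iff] at hx2 hy2
  exact h.disjoint s t (x, y) ⟨⟨hx1.1, hx2.1⟩, hy1.1, hy2.1⟩ ⟨⟨hx1.2, hx2.2⟩, hy1.2, hy2.2⟩

/-- The top side of the tile `t` continues beyond its left end: the points just above the top left
corner belong to the interior of a single tile. -/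
def ExtendsLeft {S : Type*} (r : S → Rect) (t : S) : Prop :=
  ∃ s, (r s).a < (r t).a ∧ (r t).a < (r s).b ∧ (r s).c ≤ (r t).d ∧ (r t).d < (r s).d

/-- The top side of the tile `t` continues beyond its right end. -/
def ExtendsRight {S : Type*} (r : S → Rect) (t : S) : Prop :=
  ∃ s, (r s).a < (r t).b ∧ (r t).b < (r s).b ∧ (r s).c ≤ (r t).d ∧ (r t).d < (r s).d

/-- The four sides of every tile continue beyond at least one of their ends. The statement about
the right, bottom and left sides is expressed by turning the plane by quarter turns. -/
def IsPinwheel {S : Type*} (r : S → Rect) : Prop :=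
  ∀ k t, ExtendsLeft (rotFamily^[k] r) t ∨ ExtendsRight (rotFamily^[k] r) t

theorem IsPinwheel.rotFamily {S : Type*} {r : S → Rect} (h : IsPinwheel r) :
    IsPinwheel (rotFamily r) := fun k t => h (k + 1) t

/-- At a corner of a tile, at most one of the two sides meeting there continues beyond it; here
this is said of the top side and the left side. -/
theorem IsPaving.not_extendsRight_three {S : Type*} {r : S → Rect} (h : IsPaving r) {t : S}
    (hl : ExtendsLeft r t) : ¬ ExtendsRight (FlatTorus.rotFamily^[3] r) t := by
  rintro ⟨s', h1, h2, h3, h4⟩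
  obtain ⟨s, g1, g2, g3, g4⟩ := hl
  simp only [Function.iterate_succ, Function.iterate_zero, Function.comp, FlatTorus.rotFamily,
    Rect.rot, id, neg_neg] at h1 h2 h3 h4
  have e1 : s = s' := h.eq_of_overlap (by linarith) (by linarith) (by linarith) (by linarith)
  subst e1
  have e2 : s = t := h.eq_of_overlap (by linarith [(r t).hab]) g2 (by linarith)
    (by linarith [(r t).hcd])
  subst e2
  exact lt_irrefl _ g1

theorem IsPinwheel.extendsRight_rotFamily {S : Type*} {r : S → Rect} (hp : IsPinwheel r)
    (h : IsPaving r) {t : S} (ht : ExtendsRight r t) : ExtendsRight (FlatTorus.rotFamily r) t := by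
  refine (hp 1 t).resolve_left fun h1 => h.rotFamily.not_extendsRight_three h1 ?_
  rw [← Function.iterate_succ_apply, rotFamily_four]
  exact ht

theorem IsPinwheel.extendsRight_iterate {S : Type*} {r : S → Rect} (hp : IsPinwheel r)
    (h : IsPaving r) {t : S} (ht : ExtendsRight r t) (k : ℕ) :
    ExtendsRight (FlatTorus.rotFamily^[k] r) t := by
  induction k generalizing r with
  | zero => exact ht
  | succ k ih => exact ih hp.rotFamily h.rotFamily (hp.extendsRight_rotFamily h ht)

/-- In a pinwheel paving, the four sides of a tile continue beyond their ends in the same sense of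
rotation. -/
theorem IsPinwheel.not_extendsRight_iterate {S : Type*} {r : S → Rect} (hp : IsPinwheel r)
    (h : IsPaving r) {t : S} (ht : ExtendsLeft r t) (k : ℕ) :
    ¬ ExtendsRight (FlatTorus.rotFamily^[k] r) t := by
  intro hk
  have hpk : IsPinwheel (FlatTorus.rotFamily^[k] r) := fun j t => by
    rw [← Function.iterate_add_apply]; exact hp _ t
  have := hpk.extendsRight_iterate (h.rotFamily_iterate k) hk (3 * k + 3)
  rw [← Function.iterate_add_apply, show 3 * k + 3 + k = 3 + 4 * k by ring,
    Function.iterate_add_apply, rotFamily_iterate_four_mul] at this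
  exact h.not_extendsRight_three ht this

theorem IsPinwheel.extendsLeft_iterate {S : Type*} {r : S → Rect} (hp : IsPinwheel r)
    (h : IsPaving r) {t : S} (ht : ExtendsLeft r t) (k : ℕ) :
    ExtendsLeft (FlatTorus.rotFamily^[k] r) t :=
  (hp k t).resolve_right (hp.not_extendsRight_iterate h ht k)

theorem IsPinwheel.extendsLeft_of_rotFamily {S : Type*} {r : S → Rect} (hp : IsPinwheel r)
    (h : IsPaving r) {t : S} (ht : ExtendsLeft (FlatTorus.rotFamily r) t) : ExtendsLeft r t := by
  have := hp.rotFamily.extendsLeft_iterate h.rotFamily ht 3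
  rwa [← Function.iterate_succ_apply, rotFamily_four] at this

/-- The top side of a tile that continues to the left is continued by the top side of its left
neighbour. -/
theorem IsPinwheel.exists_left {S : Type*} {r : S → Rect} (hp : IsPinwheel r)
    (h : IsPaving r) {t : S} (ht : ExtendsLeft r t) :
    ∃ t', ExtendsRight r t' ∧ (r t').b = (r t).a ∧ (r t').d = (r t).d := by
  have hn := hp.not_extendsRight_iterate h ht 3
  obtain ⟨s, g1, g2, g3, g4⟩ := ht
  obtain ⟨t', h1, h2, h3, h4⟩ := h.exists_sw (r t).a (r t).d
  have hd : (r t').d = (r t).d := by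
    by_contra hne
    have hlt := lt_of_le_of_ne h4 (Ne.symm hne)
    refine hn ⟨t', ?_⟩
    simp only [Function.iterate_succ, Function.iterate_zero, Function.comp, FlatTorus.rotFamily,
      Rect.rot, id, neg_neg]
    exact ⟨h3, hlt, neg_le_neg h2, neg_lt_neg h1⟩
  have hb : (r t').b = (r t).a := by
    by_contra hne
    have hlt := lt_of_le_of_ne h2 (Ne.symm hne)
    have : t' = t := h.eq_of_overlap (by linarith [(r t).hab]) hlt h3 (by linarith [(r t).hcd])
    subst this
    exact lt_irrefl _ h1
  exact ⟨t', ⟨s, by rw [hb, hd]; exact ⟨g1, g2, g3, g4⟩⟩, hb, hd⟩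

/-- The right side of a tile that continues downwards is continued by the right side of the
neighbour below. -/
theorem IsPinwheel.exists_below {S : Type*} {r : S → Rect} (hp : IsPinwheel r)
    (h : IsPaving r) {t : S} (ht : ExtendsRight r t) :
    ∃ t', ExtendsLeft r t' ∧ (r t').b = (r t).b ∧ (r t').d = (r t).c := by
  have hn : ¬ ExtendsLeft (FlatTorus.rotFamily^[2] r) t := fun hl => by
    have := (hp.rotFamily.rotFamily).not_extendsRight_iterate h.rotFamily.rotFamily hl 2
    rw [← Function.iterate_succ_apply, ← Function.iterate_succ_apply, rotFamily_four] at this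
    exact this ht
  obtain ⟨s, g1, g2, g3, g4⟩ := hp.extendsRight_rotFamily h ht
  simp only [FlatTorus.rotFamily, Rect.rot, neg_lt_neg_iff] at g1 g2 g3 g4
  obtain ⟨t', h1, h2, h3, h4⟩ := h.exists_sw (r t).b (r t).c
  have hb : (r t').b = (r t).b := by
    by_contra hne
    have hlt := lt_of_le_of_ne h2 (Ne.symm hne)
    refine hn ⟨t', ?_⟩
    simp only [Function.iterate_succ, Function.iterate_zero, Function.comp, FlatTorus.rotFamily,
      Rect.rot, id]
    exact ⟨neg_lt_neg hlt, neg_lt_neg h1, neg_le_neg h4, neg_lt_neg h3⟩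
  have hd : (r t').d = (r t).c := by
    by_contra hne
    have hlt := lt_of_le_of_ne h4 (Ne.symm hne)
    have : t' = t := h.eq_of_overlap h1 (by linarith [(r t).hab]) (by linarith [(r t).hcd]) hlt
    subst this
    exact lt_irrefl _ h3
  refine ⟨t', hp.extendsLeft_of_rotFamily h ⟨s, ?_⟩, hb, hd⟩
  simp only [FlatTorus.rotFamily, Rect.rot, neg_lt_neg_iff]
  rw [hb, hd]
  exact ⟨g1, g2, g3, g4⟩

/-! ### Periodic tilings of the plane -/

/-- The translates of the rectangles `R i` by vectors of `Λ` tile the plane. -/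
structure PlaneTiling (Λ : Submodule ℤ (ℝ × ℝ)) {ι : Type*} (R : ι → Rect) : Prop where
  unique : ∀ i j, ∀ l ∈ Λ, ∀ z, z ∈ (R i).inner → z + l ∈ (R j).inner → i = j ∧ l = 0
  cover : ∀ z, ∃ i, ∃ l ∈ Λ, z + l ∈ (R i).closed

/-- The family of all translates of the rectangles `R i` by vectors of `Λ`. -/
def translates (Λ : Submodule ℤ (ℝ × ℝ)) {ι : Type*} (R : ι → Rect) : ι × Λ → Rect :=
  fun s => (R s.1).shift s.2

/-- Some tile contains points arbitrarily close to `z` in a given direction. -/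
theorem PlaneTiling.exists_germ {Λ : Submodule ℤ (ℝ × ℝ)} (hΛ : LocallyFinite Λ) {ι : Type*}
    [Finite ι] {R : ι → Rect} (h : PlaneTiling Λ R) (z e : ℝ × ℝ) :
    ∃ s : ι × Λ, ∀ δ > 0, ∃ t : ℝ, 0 < t ∧ t < δ ∧ z + t • e ∈ (translates Λ R s).closed := by
  cases nonempty_fintype ι
  set M := ∑ i, (|(R i).a| + |(R i).b| + |(R i).c| + |(R i).d|) with hM
  set B := M + |z.1| + |z.2| + |e.1| + |e.2| with hB
  have hMi : ∀ i, |(R i).a| + |(R i).b| + |(R i).c| + |(R i).d| ≤ M := fun i =>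
    Finset.single_le_sum (f := fun i => |(R i).a| + |(R i).b| + |(R i).c| + |(R i).d|)
      (fun i _ => by positivity) (Finset.mem_univ i)
  have hfin : ((Set.univ : Set ι) ×ˢ {l : ℝ × ℝ | l ∈ Λ ∧ |l.1| ≤ B ∧ |l.2| ≤ B}).Finite :=
    Set.finite_univ.prod (hΛ B)
  have hfr : ∃ᶠ t : ℝ in nhdsWithin 0 (Set.Ioi 0),
      ∃ p ∈ ((Set.univ : Set ι) ×ˢ {l : ℝ × ℝ | l ∈ Λ ∧ |l.1| ≤ B ∧ |l.2| ≤ B}),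
        z + t • e + p.2 ∈ (R p.1).closed := by
    refine Filter.Eventually.frequently ?_
    filter_upwards [Ioo_mem_nhdsGT (zero_lt_one (α := ℝ))] with t ht
    obtain ⟨i, l, hl, hz⟩ := h.cover (z + t • e)
    refine ⟨(i, l), ⟨trivial, hl, ?_, ?_⟩, hz⟩
    · have h1 := hz.1.1
      have h2 := hz.1.2
      simp only [Prod.fst_add, Prod.smul_fst, smul_eq_mul] at h1 h2
      have h3 : |t * e.1| ≤ |e.1| := by
        rw [abs_mul, abs_of_pos ht.1]
        exact mul_le_of_le_one_left (abs_nonneg _) ht.2.le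
      rw [abs_le] at h3 ⊢
      constructor <;>
      linarith [hMi i, neg_abs_le (R i).a, le_abs_self (R i).b, abs_nonneg (R i).a,
        abs_nonneg (R i).b, abs_nonneg (R i).c, abs_nonneg (R i).d, neg_abs_le z.1,
        le_abs_self z.1, abs_nonneg z.2, abs_nonneg e.2]
    · have h1 := hz.2.1
      have h2 := hz.2.2
      simp only [Prod.snd_add, Prod.smul_snd, smul_eq_mul] at h1 h2
      have h3 : |t * e.2| ≤ |e.2| := by
        rw [abs_mul, abs_of_pos ht.1]
        exact mul_le_of_le_one_left (abs_nonneg _) ht.2.le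
      rw [abs_le] at h3 ⊢
      constructor <;>
      linarith [hMi i, neg_abs_le (R i).c, le_abs_self (R i).d, abs_nonneg (R i).a,
        abs_nonneg (R i).b, abs_nonneg (R i).c, abs_nonneg (R i).d, neg_abs_le z.2,
        le_abs_self z.2, abs_nonneg z.1, abs_nonneg e.1]
  obtain ⟨⟨i, l⟩, hp, hfr⟩ := (Filter.frequently_exists_finite hfin).1 hfr
  refine ⟨(i, ⟨-l, Λ.neg_mem hp.2.1⟩), fun δ hδ => ?_⟩
  obtain ⟨t, hz, ht⟩ := (hfr.and_eventually (Ioo_mem_nhdsGT hδ)).exists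
  refine ⟨t, ht.1, ht.2, ?_⟩
  obtain ⟨⟨h1, h2⟩, h3, h4⟩ := hz
  simp only [Prod.fst_add, Prod.snd_add] at h1 h2 h3 h4
  simp only [translates, Rect.shift, Rect.closed, Set.mem_prod, Set.mem_Icc, Prod.fst_add,
    Prod.snd_add, Prod.fst_neg, Prod.snd_neg]
  exact ⟨⟨by linarith, by linarith⟩, by linarith, by linarith⟩

theorem PlaneTiling.isPaving {Λ : Submodule ℤ (ℝ × ℝ)} (hΛ : LocallyFinite Λ) {ι : Type*}
    [Finite ι] {R : ι → Rect} (h : PlaneTiling Λ R) : IsPaving (translates Λ R) := by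
  -- a closed condition on points close to `x` on one side holds at `x`
  have hle : ∀ p q : ℝ, (∀ δ > 0, ∃ t, 0 < t ∧ t < δ ∧ p ≤ q + t) → p ≤ q := by
    intro p q hpq
    by_contra! hlt
    obtain ⟨t, h1, h2, h3⟩ := hpq (p - q) (by linarith)
    linarith
  refine ⟨?_, fun x y => ?_, fun x y => ?_, fun x y => ?_, fun x y => ?_⟩
  · rintro ⟨i, l⟩ ⟨j, m⟩ z hs ht
    simp only [translates, Rect.shift, Rect.inner, Set.mem_prod, Set.mem_Ioo] at hs ht
    obtain ⟨rfl, hlm⟩ := h.unique i j ((l : ℝ × ℝ) - m) (Λ.sub_mem l.2 m.2) (z - l)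
      ⟨⟨by simp only [Prod.fst_sub]; linarith, by simp only [Prod.fst_sub]; linarith⟩,
        by simp only [Prod.snd_sub]; linarith, by simp only [Prod.snd_sub]; linarith⟩
      ⟨⟨by simp; linarith, by simp; linarith⟩, by simp; linarith, by simp; linarith⟩
    rw [Prod.mk.injEq]
    exact ⟨rfl, Subtype.ext (sub_eq_zero.1 hlm)⟩
  · obtain ⟨s, hs⟩ := h.exists_germ hΛ (x, y) (1, 1)
    simp only [Rect.closed, Set.mem_prod, Set.mem_Icc, Prod.fst_add, Prod.snd_add, Prod.smul_fst,
      Prod.smul_snd, smul_eq_mul, mul_one] at hs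
    obtain ⟨t, h1, -, h2⟩ := hs 1 one_pos
    refine ⟨s, hle _ _ fun δ hδ => ?_, by linarith, hle _ _ fun δ hδ => ?_, by linarith⟩
    all_goals
      obtain ⟨t, h1, h2, h3⟩ := hs δ hδ
      exact ⟨t, h1, h2, by linarith⟩
  · obtain ⟨s, hs⟩ := h.exists_germ hΛ (x, y) (-1, 1)
    simp only [Rect.closed, Set.mem_prod, Set.mem_Icc, Prod.fst_add, Prod.snd_add, Prod.smul_fst,
      Prod.smul_snd, smul_eq_mul, mul_one, mul_neg] at hs
    obtain ⟨t, h1, -, h2⟩ := hs 1 one_pos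
    refine ⟨s, by linarith, hle _ _ fun δ hδ => ?_, hle _ _ fun δ hδ => ?_, by linarith⟩
    all_goals
      obtain ⟨t, h1, h2, h3⟩ := hs δ hδ
      exact ⟨t, h1, h2, by linarith⟩
  · obtain ⟨s, hs⟩ := h.exists_germ hΛ (x, y) (-1, -1)
    simp only [Rect.closed, Set.mem_prod, Set.mem_Icc, Prod.fst_add, Prod.snd_add, Prod.smul_fst,
      Prod.smul_snd, smul_eq_mul, mul_one, mul_neg] at hs
    obtain ⟨t, h1, -, h2⟩ := hs 1 one_pos
    refine ⟨s, by linarith, hle _ _ fun δ hδ => ?_, by linarith, hle _ _ fun δ hδ => ?_⟩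
    all_goals
      obtain ⟨t, h1, h2, h3⟩ := hs δ hδ
      exact ⟨t, h1, h2, by linarith⟩
  · obtain ⟨s, hs⟩ := h.exists_germ hΛ (x, y) (1, -1)
    simp only [Rect.closed, Set.mem_prod, Set.mem_Icc, Prod.fst_add, Prod.snd_add, Prod.smul_fst,
      Prod.smul_snd, smul_eq_mul, mul_one, mul_neg] at hs
    obtain ⟨t, h1, -, h2⟩ := hs 1 one_pos
    refine ⟨s, hle _ _ fun δ hδ => ?_, by linarith, by linarith, hle _ _ fun δ hδ => ?_⟩
    all_goals
      obtain ⟨t, h1, h2, h3⟩ := hs δ hδ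
      exact ⟨t, h1, h2, by linarith⟩

/-! ### Closed staircases in pinwheel tilings -/

theorem extendsLeft_comp {S S' : Type*} (r : S → Rect) (e : S' ≃ S) (t : S') :
    ExtendsLeft (r ∘ e) t ↔ ExtendsLeft r (e t) :=
  ⟨fun ⟨s, hs⟩ => ⟨e s, hs⟩, fun ⟨s, hs⟩ => ⟨e.symm s, by
    simpa only [Function.comp_apply, Equiv.apply_symm_apply] using hs⟩⟩

theorem extendsRight_comp {S S' : Type*} (r : S → Rect) (e : S' ≃ S) (t : S') :
    ExtendsRight (r ∘ e) t ↔ ExtendsRight r (e t) :=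
  ⟨fun ⟨s, hs⟩ => ⟨e s, hs⟩, fun ⟨s, hs⟩ => ⟨e.symm s, by
    simpa only [Function.comp_apply, Equiv.apply_symm_apply] using hs⟩⟩

theorem ExtendsLeft.translates {Λ : Submodule ℤ (ℝ × ℝ)} {ι : Type*} {R : ι → Rect} {i : ι}
    {l : Λ} (h : ExtendsLeft (translates Λ R) (i, l)) (m : Λ) :
    ExtendsLeft (FlatTorus.translates Λ R) (i, m) := by
  obtain ⟨⟨j, k⟩, h1, h2, h3, h4⟩ := h
  refine ⟨(j, k - l + m), ?_⟩
  simp only [FlatTorus.translates, Rect.shift, Submodule.coe_add, Submodule.coe_sub, Prod.fst_add,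
    Prod.fst_sub, Prod.snd_add, Prod.snd_sub] at h1 h2 h3 h4 ⊢
  exact ⟨by linarith, by linarith, by linarith, by linarith⟩

theorem ExtendsRight.translates {Λ : Submodule ℤ (ℝ × ℝ)} {ι : Type*} {R : ι → Rect} {i : ι}
    {l : Λ} (h : ExtendsRight (translates Λ R) (i, l)) (m : Λ) :
    ExtendsRight (FlatTorus.translates Λ R) (i, m) := by
  obtain ⟨⟨j, k⟩, h1, h2, h3, h4⟩ := h
  refine ⟨(j, k - l + m), ?_⟩
  simp only [FlatTorus.translates, Rect.shift, Submodule.coe_add, Submodule.coe_sub, Prod.fst_add,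
    Prod.fst_sub, Prod.snd_add, Prod.snd_sub] at h1 h2 h3 h4 ⊢
  exact ⟨by linarith, by linarith, by linarith, by linarith⟩

/-- One step of the staircase: along the top side of a tile to its left neighbour, then down the
right side of this neighbour to the next tile. -/
theorem exists_step {Λ : Submodule ℤ (ℝ × ℝ)} {ι : Type*} {R : ι → Rect}
    (h : IsPaving (translates Λ R)) (hp : IsPinwheel (translates Λ R)) {i : ι}
    (hi : ExtendsLeft (translates Λ R) (i, 0)) :
    ∃ j k, ∃ m ∈ Λ, ∃ l ∈ Λ, ExtendsRight (translates Λ R) (j, 0) ∧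
      ExtendsLeft (translates Λ R) (k, 0) ∧
      (R j).b + m.1 = (R i).a ∧ (R j).d + m.2 = (R i).d ∧
      (R k).b + l.1 = (R i).b - ((R i).b - (R i).a) ∧
      (R k).d + l.2 = (R i).d - ((R j).d - (R j).c) := by
  obtain ⟨⟨j, m⟩, hj, hj1, hj2⟩ := hp.exists_left h hi
  obtain ⟨⟨k, l⟩, hk, hk1, hk2⟩ := hp.exists_below h hj
  refine ⟨j, k, m, m.2, l, l.2, hj.translates 0, hk.translates 0, ?_⟩
  simp only [translates, Rect.shift, Submodule.coe_zero, Prod.fst_zero, Prod.snd_zero,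
    add_zero] at hj1 hj2 hk1 hk2
  exact ⟨hj1, hj2, by linarith, by linarith⟩

open Classical in
/-- The staircase descending to the left from a tile closes up on the torus. It runs along the
top sides of distinct tiles of one sense of rotation, and the right sides of distinct tiles of the
other sense. -/
theorem exists_mem_of_isPinwheel {Λ : Submodule ℤ (ℝ × ℝ)} {ι : Type*} [Fintype ι] {R : ι → Rect}
    (h : IsPaving (translates Λ R)) (hp : IsPinwheel (translates Λ R))
    (hne : ∃ i, ExtendsLeft (translates Λ R) (i, 0)) :
    ∃ l ∈ Λ, 0 < l.1 ∧ 0 < l.2 ∧ l.1 + l.2 ≤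
      (∑ i with ExtendsLeft (translates Λ R) (i, 0), ((R i).b - (R i).a)) +
      ∑ i with ExtendsRight (translates Λ R) (i, 0), ((R i).d - (R i).c) := by
  obtain ⟨i₀, hi₀⟩ := hne
  let C := {i // ExtendsLeft (translates Λ R) (i, 0)}
  have hstep := fun i : C => exists_step h hp i.2
  choose α k m hm l hl hα hk e1 e2 e3 e4 using hstep
  have hαinj : Function.Injective α := by
    intro i i' hii
    -- both tiles cover the germ to the south-east of the top right corner of the tile `α i`
    have h1 := e1 i
    have h2 := e2 i
    have h1' := e1 i'
    have h2' := e2 i'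
    rw [← hii] at h1' h2'
    have : ((i : ι), (⟨0, Λ.zero_mem⟩ : Λ)) =
        ((i' : ι), ⟨m i - m i', Λ.sub_mem (hm i) (hm i')⟩) := by
      refine h.eq_of_overlap ?_ ?_ ?_ ?_ <;>
      simp only [translates, Rect.shift, Prod.fst_zero, Prod.snd_zero, add_zero, Prod.fst_sub,
        Prod.snd_sub] <;>
      linarith [(R i).hab, (R i').hab, (R i).hcd, (R i').hcd]
    exact Subtype.ext (Prod.ext_iff.1 this).1
  let f : C → C := fun i => ⟨k i, hk i⟩
  obtain ⟨n, n', hlt, heq⟩ := Set.Finite.exists_lt_map_eq_of_forall_mem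
    (f := fun n : ℕ => f^[n] ⟨i₀, hi₀⟩) (t := Set.univ) (fun _ => Set.mem_univ _) Set.finite_univ
  set y := f^[n] ⟨i₀, hi₀⟩ with hy
  have hper : y ∈ Function.periodicPts f := by
    refine Function.mk_mem_periodicPts (n := n' - n) (by omega) ?_
    rw [Function.IsPeriodicPt, Function.IsFixedPt, hy, ← Function.iterate_add_apply,
      Nat.sub_add_cancel hlt.le]
    exact heq.symm
  set N := Function.minimalPeriod f y with hN
  have hNpos : 0 < N := Function.minimalPeriod_pos_of_mem_periodicPts hper
  have hfix : f^[N] y = y := Function.iterate_minimalPeriod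
  have hinj : Set.InjOn (fun n => f^[n] y) (Finset.range N) := by
    intro a ha b hb hab
    rw [Finset.coe_range, Set.mem_Iio] at ha hb
    exact (Function.iterate_injOn_Iio_minimalPeriod) ha hb hab
  have hsum1 : ∑ n ∈ Finset.range N, (l (f^[n] y)).1 =
      -∑ n ∈ Finset.range N, ((R (f^[n] y)).b - (R (f^[n] y)).a) := by
    have h1 : ∀ n, (l (f^[n] y)).1 = -((R (f^[n] y)).b - (R (f^[n] y)).a) -
        ((R (f^[n + 1] y)).b - (R (f^[n] y)).b) := by
      intro n
      rw [Function.iterate_succ_apply']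
      linarith [e3 (f^[n] y)]
    rw [Finset.sum_congr rfl fun n _ => h1 n, Finset.sum_sub_distrib, Finset.sum_neg_distrib,
      Finset.sum_range_sub (fun n => (R (f^[n] y)).b), hfix]
    simp
  have hsum2 : ∑ n ∈ Finset.range N, (l (f^[n] y)).2 =
      -∑ n ∈ Finset.range N, ((R (α (f^[n] y))).d - (R (α (f^[n] y))).c) := by
    have h1 : ∀ n, (l (f^[n] y)).2 = -((R (α (f^[n] y))).d - (R (α (f^[n] y))).c) -
        ((R (f^[n + 1] y)).d - (R (f^[n] y)).d) := by
      intro n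
      rw [Function.iterate_succ_apply']
      linarith [e4 (f^[n] y)]
    rw [Finset.sum_congr rfl fun n _ => h1 n, Finset.sum_sub_distrib, Finset.sum_neg_distrib,
      Finset.sum_range_sub (fun n => (R (f^[n] y)).d), hfix]
    simp
  refine ⟨-∑ n ∈ Finset.range N, l (f^[n] y),
    Λ.neg_mem (Λ.sum_mem fun n _ => hl _), ?_, ?_, ?_⟩
  · rw [Prod.fst_neg, Prod.fst_sum, hsum1, neg_neg]
    exact Finset.sum_pos (fun n _ => sub_pos.2 (R _).hab) (Finset.nonempty_range_iff.2 hNpos.ne')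
  · rw [Prod.snd_neg, Prod.snd_sum, hsum2, neg_neg]
    exact Finset.sum_pos (fun n _ => sub_pos.2 (R _).hcd) (Finset.nonempty_range_iff.2 hNpos.ne')
  · rw [Prod.fst_neg, Prod.fst_sum, hsum1, neg_neg, Prod.snd_neg, Prod.snd_sum, hsum2, neg_neg]
    refine add_le_add ?_ ?_
    · rw [← Finset.sum_image (f := fun i => (R i).b - (R i).a)
        (g := fun n => ((f^[n] y : C) : ι)) fun a ha b hb hab => hinj ha hb (Subtype.ext hab)]
      refine Finset.sum_le_sum_of_subset_of_nonneg ?_ fun i _ _ => (sub_pos.2 (R i).hab).le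
      intro i hi
      obtain ⟨n, -, rfl⟩ := Finset.mem_image.1 hi
      exact Finset.mem_filter.2 ⟨Finset.mem_univ _, (f^[n] y).2⟩
    · rw [← Finset.sum_image (f := fun i => (R i).d - (R i).c)
        (g := fun n => α (f^[n] y)) fun a ha b hb hab => hinj ha hb (hαinj hab)]
      refine Finset.sum_le_sum_of_subset_of_nonneg ?_ fun i _ _ => (sub_pos.2 (R i).hcd).le
      intro i hi
      obtain ⟨n, -, rfl⟩ := Finset.mem_image.1 hi
      exact Finset.mem_filter.2 ⟨Finset.mem_univ _, hα _⟩

/-! ### Turning a periodic tiling by a quarter turn -/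

/-- The image of `Λ` under the rotation `(x, y) ↦ (-y, x)`, written as a preimage. -/
def rotLattice (Λ : Submodule ℤ (ℝ × ℝ)) : Submodule ℤ (ℝ × ℝ) :=
  Λ.comap ((LinearMap.snd ℤ ℝ ℝ).prod (-LinearMap.fst ℤ ℝ ℝ))

theorem mem_rotLattice {Λ : Submodule ℤ (ℝ × ℝ)} {l : ℝ × ℝ} :
    l ∈ rotLattice Λ ↔ (l.2, -l.1) ∈ Λ := Iff.rfl

theorem rot_mem_rotLattice {Λ : Submodule ℤ (ℝ × ℝ)} {l : ℝ × ℝ} (hl : l ∈ Λ) :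
    (-l.2, l.1) ∈ rotLattice Λ := by
  rw [mem_rotLattice, neg_neg]
  exact hl

theorem LocallyFinite.rot {Λ : Submodule ℤ (ℝ × ℝ)} (h : LocallyFinite Λ) :
    LocallyFinite (rotLattice Λ) := by
  intro B
  refine ((h B).image fun l => (-l.2, l.1)).subset ?_
  rintro ⟨x, y⟩ ⟨h1, h2, h3⟩
  exact ⟨(y, -x), ⟨h1, h3, by simpa using h2⟩, by simp⟩

/-- Turning a lattice vector by a quarter turn, as a bijection between the translates of tiles. -/
def rotEquiv (Λ : Submodule ℤ (ℝ × ℝ)) (ι : Type*) : ι × Λ ≃ ι × rotLattice Λ where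
  toFun s := (s.1, ⟨(-s.2.1.2, s.2.1.1), rot_mem_rotLattice s.2.2⟩)
  invFun s := (s.1, ⟨(s.2.1.2, -s.2.1.1), s.2.2⟩)
  left_inv s := by simp
  right_inv s := by simp

theorem rotFamily_translates (Λ : Submodule ℤ (ℝ × ℝ)) {ι : Type*} (R : ι → Rect) :
    rotFamily (translates Λ R) =
      translates (rotLattice Λ) (rotFamily R) ∘ rotEquiv Λ ι := by
  funext s
  simp only [rotFamily, translates, rotEquiv, Rect.rot, Rect.shift, Function.comp_apply,
    Equiv.coe_fn_mk, Rect.mk.injEq, and_true]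
  exact ⟨by ring, by ring⟩

theorem PlaneTiling.rot {Λ : Submodule ℤ (ℝ × ℝ)} {ι : Type*} {R : ι → Rect}
    (h : PlaneTiling Λ R) : PlaneTiling (rotLattice Λ) (rotFamily R) where
  unique i j l hl z hi hj := by
    obtain ⟨rfl, h0⟩ := h.unique i j (l.2, -l.1) hl (z.2, -z.1)
      ⟨hi.2, lt_neg.1 hi.1.2, neg_lt.1 hi.1.1⟩
      ⟨hj.2, by
        have h1 := hj.1.1
        have h2 := hj.1.2
        simp only [rotFamily, Rect.rot, Prod.fst_add] at h1 h2
        exact ⟨by simp; linarith, by simp; linarith⟩⟩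
    rw [Prod.mk_eq_zero, neg_eq_zero] at h0
    exact ⟨rfl, Prod.ext h0.2 h0.1⟩
  cover z := by
    obtain ⟨i, l, hl, h1, h2, h3⟩ := h.cover (z.2, -z.1)
    refine ⟨i, (-l.2, l.1), rot_mem_rotLattice hl, ⟨?_, ?_⟩, h1⟩ <;>
    simp only [rotFamily, Rect.rot, Prod.fst_add, Prod.snd_add] at h2 h3 ⊢ <;>
    linarith

open Classical in
/-- In a pinwheel tiling there are a closed staircase ascending to the right and a closed staircase
descending to the right, which together are not longer than the tiling. -/
theorem exists_mem_mem_of_isPinwheel {Λ : Submodule ℤ (ℝ × ℝ)} (hΛ : LocallyFinite Λ)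
    {ι : Type*} [Fintype ι] {R : ι → Rect} (h : PlaneTiling Λ R)
    (hp : IsPinwheel (translates Λ R)) :
    ∃ l ∈ Λ, ∃ m ∈ Λ, 0 < l.1 * l.2 ∧ m.1 * m.2 < 0 ∧
      l1norm l + l1norm m ≤ ∑ i, (((R i).b - (R i).a) + ((R i).d - (R i).c)) := by
  have hP := h.isPaving hΛ
  have hne : ∃ i, ExtendsLeft (translates Λ R) (i, 0) := by
    obtain ⟨i, -⟩ := h.cover 0
    rcases hp 0 (i, 0) with hi | hi
    · exact ⟨i, hi⟩
    · obtain ⟨⟨k, l⟩, hk, -⟩ := hp.exists_below hP hi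
      exact ⟨k, hk.translates 0⟩
  have hdich : ∀ i, ExtendsRight (translates Λ R) (i, 0) ↔
      ¬ ExtendsLeft (translates Λ R) (i, 0) := fun i =>
    ⟨fun h1 h2 => hp.not_extendsRight_iterate hP h2 0 h1, fun h1 => (hp 0 (i, 0)).resolve_left h1⟩
  have hp' : IsPinwheel (translates (rotLattice Λ) (rotFamily R)) := by
    intro k t
    have := hp.rotFamily k ((rotEquiv Λ ι).symm t)
    rw [rotFamily_translates, rotFamily_iterate_comp, extendsLeft_comp, extendsRight_comp,
      Equiv.apply_symm_apply] at this
    exact this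
  have hleft : ∀ i, ExtendsLeft (translates (rotLattice Λ) (rotFamily R)) (i, 0) ↔
      ExtendsLeft (translates Λ R) (i, 0) := by
    intro i
    have : ExtendsLeft (rotFamily (translates Λ R)) (i, 0) ↔
        ExtendsLeft (translates (rotLattice Λ) (rotFamily R)) (rotEquiv Λ ι (i, 0)) := by
      rw [rotFamily_translates, extendsLeft_comp]
    exact ⟨fun h1 => hp.extendsLeft_of_rotFamily hP (this.2 (h1.translates _)),
      fun h1 => (this.1 (hp.extendsLeft_iterate hP h1 1)).translates 0⟩
  have hP' := h.rot.isPaving hΛ.rot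
  have hright : ∀ i, ExtendsRight (translates (rotLattice Λ) (rotFamily R)) (i, 0) ↔
      ExtendsRight (translates Λ R) (i, 0) := by
    intro i
    rw [hdich, ← hleft]
    exact ⟨fun h1 h2 => hp'.not_extendsRight_iterate hP' h2 0 h1,
      fun h1 => (hp' 0 (i, 0)).resolve_left h1⟩
  obtain ⟨l, hl, hl1, hl2, hl3⟩ := exists_mem_of_isPinwheel hP hp hne
  obtain ⟨m, hm, hm1, hm2, hm3⟩ := exists_mem_of_isPinwheel hP' hp'
    (hne.imp fun i hi => (hleft i).2 hi)
  refine ⟨l, hl, _, mem_rotLattice.1 hm, mul_pos hl1 hl2, by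
    simpa using mul_pos hm2 hm1, ?_⟩
  simp only [hleft, hright, hdich] at hl3 hm3
  simp only [l1norm, abs_neg, abs_of_pos hl1, abs_of_pos hl2, abs_of_pos hm1, abs_of_pos hm2]
  rw [Finset.sum_add_distrib,
    ← Finset.sum_filter_add_sum_filter_not Finset.univ
      (fun i => ExtendsLeft (translates Λ R) (i, 0)) fun i => (R i).b - (R i).a,
    ← Finset.sum_filter_add_sum_filter_not Finset.univ
      (fun i => ExtendsLeft (translates Λ R) (i, 0)) fun i => (R i).d - (R i).c]
  simp only [rotFamily, Rect.rot, neg_sub_neg] at hm3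
  linarith

/-! ### Removing a tile that fits exactly under its upper neighbours -/

/-- Half of the total perimeter of a finite family of rectangles. -/
def totalLength {ι : Type*} [Fintype ι] (R : ι → Rect) : ℝ :=
  ∑ i, (((R i).b - (R i).a) + ((R i).d - (R i).c))

/-- If the top side of a tile ends at both of its corners, then either the tile lies on top of a
translate of itself, or it can be extended upwards, at the expense of its upper neighbours, until
one of these disappears. Extending it does not increase the length: its height grows by as much as
the height of each upper neighbour shrinks. -/
theorem PlaneTiling.mem_or_exists_smaller {Λ : Submodule ℤ (ℝ × ℝ)} (hΛ : LocallyFinite Λ)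
    {ι : Type} [Fintype ι] {R : ι → Rect} (h : PlaneTiling Λ R) {i : ι}
    (hL : ¬ ExtendsLeft (translates Λ R) (i, 0)) (hR : ¬ ExtendsRight (translates Λ R) (i, 0)) :
    (0, (R i).d - (R i).c) ∈ Λ ∨ ∃ (ι' : Type) (_ : Fintype ι') (R' : ι' → Rect),
      PlaneTiling Λ R' ∧ Fintype.card ι' < Fintype.card ι ∧ totalLength R' ≤ totalLength R := by
  classical
  have hP := h.isPaving hΛ
  have hov : ∀ j k, ∀ l ∈ Λ, ∀ m ∈ Λ, (R j).a + l.1 < (R k).b + m.1 →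
      (R k).a + m.1 < (R j).b + l.1 → (R j).c + l.2 < (R k).d + m.2 →
      (R k).c + m.2 < (R j).d + l.2 → j = k ∧ l = m := by
    intro j k l hl m hm h1 h2 h3 h4
    have : (j, (⟨l, hl⟩ : Λ)) = (k, ⟨m, hm⟩) := hP.eq_of_overlap h1 h2 h3 h4
    rw [Prod.mk.injEq, Subtype.mk.injEq] at this
    exact this
  -- the translates of tiles resting on the top side of the tile `i`
  let Above : ι → ℝ × ℝ → Prop := fun j l => l ∈ Λ ∧ (R j).c + l.2 = (R i).d ∧
    (R j).a + l.1 < (R i).b ∧ (R i).a < (R j).b + l.1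
  have habove : ∀ j l, Above j l → (R i).a ≤ (R j).a + l.1 ∧ (R j).b + l.1 ≤ (R i).b := by
    rintro j l ⟨hl, h1, h2, h3⟩
    constructor
    · by_contra! hlt
      refine hL ⟨(j, ⟨l, hl⟩), ?_⟩
      simp only [translates, Rect.shift, Submodule.coe_zero, Prod.fst_zero, Prod.snd_zero, add_zero]
      exact ⟨hlt, h3, h1.le, by linarith [(R j).hcd]⟩
    · by_contra! hlt
      refine hR ⟨(j, ⟨l, hl⟩), ?_⟩
      simp only [translates, Rect.shift, Submodule.coe_zero, Prod.fst_zero, Prod.snd_zero, add_zero]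
      exact ⟨h2, hlt, h1.le, by linarith [(R j).hcd]⟩
  have hexists : ∀ x, (R i).a ≤ x → x < (R i).b →
      ∃ j l, Above j l ∧ (R j).a + l.1 ≤ x ∧ x < (R j).b + l.1 := by
    intro x hx1 hx2
    obtain ⟨⟨j, l, hl⟩, h1, h2, h3, h4⟩ := hP.exists_ne x (R i).d
    simp only [translates, Rect.shift] at h1 h2 h3 h4
    refine ⟨j, l, ⟨hl, ?_, by linarith, by linarith⟩, h1, h2⟩
    by_contra hne
    have hlt := lt_of_le_of_ne h3 hne
    obtain ⟨rfl, rfl⟩ := hov j i l hl 0 Λ.zero_mem (by simp; linarith) (by simp; linarith)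
      (by simp; linarith) (by simp; linarith [(R i).hcd])
    simp at h4
  have huniq : ∀ j l m, Above j l → Above j m → l = m := by
    intro j l m hl hm
    obtain ⟨hl1, hl2⟩ := habove j l hl
    obtain ⟨hm1, hm2⟩ := habove j m hm
    have h1 := hl.2.1
    have h2 := hm.2.1
    have h3 := (R j).hab
    have h4 := (R i).hcd
    -- otherwise the tile `i` would overlap with a horizontal translate of itself
    exact (hov i i l hl.1 m hm.1 (by linarith) (by linarith) (by linarith) (by linarith)).2
  by_cases hi : ∃ l, Above i l
  · left
    obtain ⟨l, hl⟩ := hi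
    obtain ⟨h1, h2⟩ := habove i l hl
    have h3 := hl.2.1
    convert hl.1 using 1
    exact Prod.ext (by simp only; linarith) (by simp only; linarith)
  right
  let J : Finset ι := Finset.univ.filter fun j => ∃ l, Above j l
  have hJ : ∀ j, j ∈ J ↔ ∃ l, Above j l := fun j => by simp [J]
  have hiJ : i ∉ J := fun hi' => hi ((hJ i).1 hi')
  have hJne : J.Nonempty := by
    obtain ⟨j, l, hl, -⟩ := hexists (R i).a le_rfl (R i).hab
    exact ⟨j, (hJ j).2 ⟨l, hl⟩⟩
  obtain ⟨j₀, hj₀, hmin⟩ := Finset.exists_min_image J (fun j => (R j).d - (R j).c) hJne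
  set η := (R j₀).d - (R j₀).c with hη
  have hη0 : 0 < η := sub_pos.2 (R j₀).hcd
  let ι' := {j // j ∈ J → η < (R j).d - (R j).c}
  let R' : ι' → Rect := fun j =>
    { a := (R j).a
      b := (R j).b
      c := (R j).c + if (j : ι) ∈ J then η else 0
      d := (R j).d + if (j : ι) = i then η else 0
      hab := (R j).hab
      hcd := by
        have := (R j).hcd
        have hj := j.2
        split_ifs with h1 h2 <;> first | linarith | linarith [hj h1] }
  -- a point of a new tile lies in an old one, where it is not in the part that has been removed
  -- unless the new tile is the extension of `i`
  have hold : ∀ j : ι', ∀ z, z ∈ (R' j).inner → ∃ k, ∃ m ∈ Λ,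
      ((R k).a + m.1 ≤ z.1 ∧ z.1 < (R k).b + m.1 ∧ (R k).c + m.2 ≤ z.2 ∧ z.2 < (R k).d + m.2) ∧
      ((k = j ∧ m = 0 ∧ (k ∈ J → (R k).c + η < z.2)) ∨
        ((j : ι) = i ∧ Above k m ∧ z.2 < (R k).c + m.2 + η)) := by
    rintro j z ⟨⟨h1, h2⟩, h3, h4⟩
    simp only [R'] at h1 h2 h3 h4
    by_cases hcase : (j : ι) = i ∧ (R i).d ≤ z.2
    · obtain ⟨hj, hz⟩ := hcase
      rw [if_pos hj] at h4
      rw [hj] at h1 h2 h4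
      obtain ⟨k, m, hm, hm1, hm2⟩ := hexists z.1 h1.le h2
      have := hmin k ((hJ k).2 ⟨m, hm⟩)
      have hm3 := hm.2.1
      exact ⟨k, m, hm.1, ⟨hm1, hm2, by linarith, by linarith⟩, Or.inr ⟨hj, hm, by linarith⟩⟩
    · refine ⟨j, 0, Λ.zero_mem, ⟨by simpa using h1.le, by simpa using h2, ?_, ?_⟩,
        Or.inl ⟨rfl, rfl, fun hj => by rwa [if_pos hj] at h3⟩⟩
      · rw [Prod.snd_zero, add_zero]
        split_ifs at h3 <;> linarith
      · rw [Prod.snd_zero, add_zero]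
        split_ifs at h4 with hji
        · rw [hji]
          exact not_le.1 fun hle => hcase ⟨hji, hle⟩
        · linarith
  refine ⟨ι', inferInstance, R', ⟨?_, ?_⟩, ?_, ?_⟩
  · intro j j' l hl z hz hz'
    obtain ⟨k, m, hm, ⟨h1, h2, h3, h4⟩, hk⟩ := hold j z hz
    obtain ⟨k', m', hm', ⟨h1', h2', h3', h4'⟩, hk'⟩ := hold j' (z + l) hz'
    simp only [Prod.fst_add, Prod.snd_add] at h1' h2' h3' h4' hk'
    obtain ⟨rfl, hmm⟩ := hov k k' (m + l) (Λ.add_mem hm hl) m' hm' (by simp; linarith)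
      (by simp; linarith) (by simp; linarith) (by simp; linarith)
    have hmm2 : m.2 + l.2 = m'.2 := by rw [← hmm, Prod.snd_add]
    rcases hk with ⟨hkj, rfl, hkJ⟩ | ⟨hji, hA, hlt⟩
    · rcases hk' with ⟨hkj', rfl, -⟩ | ⟨-, hA', hlt'⟩
      · exact ⟨Subtype.ext (hkj.symm.trans hkj'), by simpa using hmm⟩
      · have := hkJ ((hJ k).2 ⟨_, hA'⟩)
        rw [Prod.snd_zero] at hmm2
        linarith
    · rcases hk' with ⟨-, rfl, hkJ'⟩ | ⟨hji', hA', -⟩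
      · have := hkJ' ((hJ k).2 ⟨_, hA⟩)
        rw [Prod.snd_zero] at hmm2
        linarith
      · refine ⟨Subtype.ext (hji.trans hji'.symm), ?_⟩
        rw [huniq k m m' hA hA'] at hmm
        simpa using hmm
  · intro z
    obtain ⟨j, l, hl, ⟨h1, h2⟩, h3, h4⟩ := h.cover z
    simp only [Prod.fst_add, Prod.snd_add] at h1 h2 h3 h4
    by_cases hcase : j ∈ J ∧ z.2 + l.2 ≤ (R j).c + η
    · obtain ⟨hj, hz⟩ := hcase
      obtain ⟨m, hm⟩ := (hJ j).1 hj
      obtain ⟨hm1, hm2⟩ := habove j m hm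
      have hm3 := hm.2.1
      refine ⟨⟨i, fun h => absurd h hiJ⟩, l + m, Λ.add_mem hl hm.1, ⟨?_, ?_⟩, ?_, ?_⟩ <;>
      simp only [R', if_true, if_neg hiJ, Prod.fst_add, Prod.snd_add] <;>
      linarith [(R i).hcd]
    · have hj : j ∈ J → (R j).c + η < z.2 + l.2 := fun hj => not_le.1 fun hle => hcase ⟨hj, hle⟩
      refine ⟨⟨j, fun hjJ => by linarith [hj hjJ]⟩, l, hl, ⟨h1, h2⟩, ?_, ?_⟩ <;>
      simp only [R', Prod.snd_add]
      · split_ifs with hjJ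
        · exact (hj hjJ).le
        · linarith
      · split_ifs <;> linarith
  · exact Fintype.card_subtype_lt (x := j₀) fun hj => lt_irrefl _ (hj hj₀)
  · let g : ι → ℝ := fun j => ((R j).b - (R j).a) +
      (((R j).d + if j = i then η else 0) - ((R j).c + if j ∈ J then η else 0))
    have hg : ∀ j, 0 ≤ g j := by
      intro j
      have h1 := (R j).hab
      have h2 := (R j).hcd
      have h3 := hmin j
      simp only [g]
      split_ifs with h4 h5 h5 <;> first | linarith | linarith [h3 h5]
    calc totalLength R' = ∑ j : ι', g j := rfl
      _ = ∑ j with (j ∈ J → η < (R j).d - (R j).c), g j :=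
        (Finset.sum_subtype _ (by simp) g).symm
      _ ≤ ∑ j, g j := Finset.sum_le_sum_of_subset_of_nonneg (Finset.filter_subset _ _)
        fun j _ _ => hg j
      _ = totalLength R + (η - J.card * η) := by
        rw [show J.card * η = ∑ j, if j ∈ J then η else 0 by simp,
          show η = ∑ j, if j = i then η else 0 by simp, ← Finset.sum_sub_distrib, totalLength,
          ← Finset.sum_add_distrib]
        refine Finset.sum_congr rfl fun j _ => ?_
        simp only [g]
        simp only [Finset.sum_ite_eq', Finset.mem_univ, if_true]
        ring
      _ ≤ totalLength R := by
        have : (1 : ℝ) ≤ J.card := by exact_mod_cast hJne.card_pos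
        nlinarith

theorem rotLattice_four (Λ : Submodule ℤ (ℝ × ℝ)) :
    rotLattice (rotLattice (rotLattice (rotLattice Λ))) = Λ := by
  ext l
  simp [mem_rotLattice]

theorem totalLength_rotFamily {ι : Type*} [Fintype ι] (R : ι → Rect) :
    totalLength (rotFamily R) = totalLength R := by
  refine Finset.sum_congr rfl fun i _ => ?_
  simp only [rotFamily, Rect.rot]
  ring

/-- A tiling with the smallest number of tiles among the tilings that are not longer is a pinwheel
tiling, unless some tile closes up around the torus. -/
theorem PlaneTiling.isPinwheel {Λ : Submodule ℤ (ℝ × ℝ)} (hΛ : LocallyFinite Λ)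
    {ι : Type} [Fintype ι] {R : ι → Rect} (h : PlaneTiling Λ R)
    (hx : ∀ i, ((R i).b - (R i).a, 0) ∉ Λ) (hy : ∀ i, (0, (R i).d - (R i).c) ∉ Λ)
    (hmin : ∀ (ι' : Type) (_ : Fintype ι') (R' : ι' → Rect), PlaneTiling Λ R' →
      Fintype.card ι' < Fintype.card ι → totalLength R < totalLength R') :
    IsPinwheel (translates Λ R) := by
  intro k
  induction k generalizing Λ R with
  | zero =>
    rintro ⟨i, l⟩
    by_contra! hcon
    rcases h.mem_or_exists_smaller hΛ (i := i) (fun h1 => hcon.1 (h1.translates _))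
      (fun h1 => hcon.2 (h1.translates _)) with h1 | ⟨ι', _, R', h1, h2, h3⟩
    · exact hy i h1
    · exact not_lt.2 h3 (hmin ι' _ R' h1 h2)
  | succ k ih =>
    intro t
    rw [Function.iterate_succ_apply, rotFamily_translates, rotFamily_iterate_comp,
      extendsLeft_comp, extendsRight_comp]
    refine ih hΛ.rot h.rot (fun i hi => hy i ?_) (fun i hi => hx i ?_)
      (fun ι' _ R' h1 h2 => ?_) _
    · convert Λ.neg_mem (mem_rotLattice.1 hi) using 1
      simp only [rotFamily, Rect.rot, Prod.neg_mk, neg_zero, Prod.mk.injEq, true_and]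
      ring
    · simpa [mem_rotLattice, rotFamily, Rect.rot] using hi
    · have h3 := h1.rot.rot.rot
      rw [rotLattice_four] at h3
      have := hmin ι' _ _ h3 h2
      rwa [totalLength_rotFamily, totalLength_rotFamily, totalLength_rotFamily,
        ← totalLength_rotFamily R] at this

/-- A lower bound for the length of a tiling holds in general if it holds for tilings with a tile
that closes up around the torus, and for pairs of lattice vectors in the two quadrants. -/
theorem PlaneTiling.le_totalLength {Λ : Submodule ℤ (ℝ × ℝ)} (hΛ : LocallyFinite Λ) {M : EReal}
    (hx : ∀ (ι : Type) (_ : Fintype ι) (R : ι → Rect), PlaneTiling Λ R →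
      ∀ i, ((R i).b - (R i).a, 0) ∈ Λ → M ≤ totalLength R)
    (hy : ∀ (ι : Type) (_ : Fintype ι) (R : ι → Rect), PlaneTiling Λ R →
      ∀ i, (0, (R i).d - (R i).c) ∈ Λ → M ≤ totalLength R)
    (hxy : ∀ l ∈ Λ, ∀ m ∈ Λ, 0 < l.1 * l.2 → m.1 * m.2 < 0 →
      M ≤ (l1norm l + l1norm m : ℝ))
    (ι : Type) [Fintype ι] (R : ι → Rect) (h : PlaneTiling Λ R) : M ≤ totalLength R := by
  induction hn : Fintype.card ι using Nat.strong_induction_on generalizing ι with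
  | _ n ih =>
    subst hn
    by_contra! hlt
    obtain ⟨l, hl, m, hm, h1, h2, h3⟩ := exists_mem_mem_of_isPinwheel hΛ h
      (h.isPinwheel hΛ (fun i hi => not_lt.2 (hx ι _ R h i hi) hlt)
        (fun i hi => not_lt.2 (hy ι _ R h i hi) hlt)
        fun ι' _ R' h1 h2 => EReal.coe_lt_coe_iff.1 (hlt.trans_le (ih _ h2 ι' R' h1 rfl)))
    exact not_lt.2 ((hxy l hl m hm h1 h2).trans (EReal.coe_le_coe_iff.2 h3)) hlt

/-! ### The covolume is the total area of the tiles -/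

section Covolume

open MeasureTheory
open scoped Pointwise

theorem Rect.volume_closed (R : Rect) :
    volume R.closed = ENNReal.ofReal ((R.b - R.a) * (R.d - R.c)) := by
  rw [Rect.closed, Measure.volume_eq_prod, Measure.prod_prod, Real.volume_Icc, Real.volume_Icc,
    ENNReal.ofReal_mul (sub_pos.2 R.hab).le]

theorem Rect.volume_inner (R : Rect) :
    volume R.inner = ENNReal.ofReal ((R.b - R.a) * (R.d - R.c)) := by
  rw [Rect.inner, Measure.volume_eq_prod, Measure.prod_prod, Real.volume_Ioo, Real.volume_Ioo,
    ENNReal.ofReal_mul (sub_pos.2 R.hab).le]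

theorem Rect.measurableSet_inner (R : Rect) : MeasurableSet R.inner :=
  measurableSet_Ioo.prod measurableSet_Ioo

/-- The covolume is the measure of a fundamental domain, which the translates of the closed tiles
cover, and in which the translates of their interiors are disjoint. -/
theorem PlaneTiling.covolume_eq {Λ : Submodule ℤ (ℝ × ℝ)} (hΛ : IsPlaneLattice Λ) {ι : Type*}
    [Fintype ι] {R : ι → Rect} (h : PlaneTiling Λ R) :
    ZLattice.covolume Λ volume = ∑ i, ((R i).b - (R i).a) * ((R i).d - (R i).c) := by
  obtain ⟨e, rfl⟩ := hΛ
  set Λ := Submodule.span ℤ (Set.range e)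
  set F := ZSpan.fundamentalDomain e
  have : MeasurableVAdd Λ (ℝ × ℝ) :=
    inferInstanceAs (MeasurableVAdd Λ.toAddSubgroup (ℝ × ℝ))
  have : VAddInvariantMeasure Λ (ℝ × ℝ) volume :=
    inferInstanceAs (VAddInvariantMeasure Λ.toAddSubgroup (ℝ × ℝ) volume)
  have hF : IsAddFundamentalDomain Λ F volume := ZSpan.isAddFundamentalDomain e volume
  have harea : ∀ i, 0 ≤ ((R i).b - (R i).a) * ((R i).d - (R i).c) := fun i =>
    mul_nonneg (sub_pos.2 (R i).hab).le (sub_pos.2 (R i).hcd).le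
  have hvol : volume F = ENNReal.ofReal (∑ i, ((R i).b - (R i).a) * ((R i).d - (R i).c)) := by
    rw [ENNReal.ofReal_sum_of_nonneg fun i _ => harea i]
    refine le_antisymm ?_ ?_
    · calc volume F ≤ volume (⋃ i, ⋃ l : Λ, (l +ᵥ (R i).closed) ∩ F) := by
            refine measure_mono fun z hz => ?_
            obtain ⟨i, l, hl, hzl⟩ := h.cover z
            refine Set.mem_iUnion₂.2 ⟨i, -⟨l, hl⟩, ?_, hz⟩
            rw [Set.mem_vadd_set_iff_neg_vadd_mem, neg_neg, Submodule.vadd_def, vadd_eq_add,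
              add_comm]
            exact hzl
        _ ≤ ∑ i, volume (⋃ l : Λ, (l +ᵥ (R i).closed) ∩ F) := by
            simpa using measure_iUnion_fintype_le volume
              fun i => ⋃ l : Λ, (l +ᵥ (R i).closed) ∩ F
        _ ≤ ∑ i, ∑' l : Λ, volume ((l +ᵥ (R i).closed) ∩ F) :=
            Finset.sum_le_sum fun i _ => measure_iUnion_le _
        _ = _ := by
            refine Finset.sum_congr rfl fun i _ => ?_
            rw [← hF.measure_eq_tsum, Rect.volume_closed]
    · have hdisj : Pairwise (Function.onFun Disjoint
          fun s : ι × Λ => (s.2 +ᵥ (R s.1).inner) ∩ F) := by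
        rintro ⟨i, l⟩ ⟨j, m⟩ hne
        rw [Function.onFun, Set.disjoint_left]
        rintro z ⟨hz, -⟩ ⟨hz', -⟩
        rw [Set.mem_vadd_set_iff_neg_vadd_mem, Submodule.vadd_def, vadd_eq_add] at hz hz'
        obtain ⟨rfl, h0⟩ := h.unique i j ((l : ℝ × ℝ) - m) (Λ.sub_mem l.2 m.2) _ hz
          (by convert hz' using 1; push_cast; abel)
        exact hne (Prod.ext rfl (Subtype.ext (sub_eq_zero.1 h0)))
      calc _ = ∑ i, ∑' l : Λ, volume ((l +ᵥ (R i).inner) ∩ F) := by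
            refine Finset.sum_congr rfl fun i _ => ?_
            rw [← hF.measure_eq_tsum, Rect.volume_inner]
        _ = ∑' s : ι × Λ, volume ((s.2 +ᵥ (R s.1).inner) ∩ F) := by
            rw [ENNReal.tsum_prod (f := fun i (l : Λ) => volume ((l +ᵥ (R i).inner) ∩ F)),
              tsum_fintype]
        _ = volume (⋃ s : ι × Λ, (s.2 +ᵥ (R s.1).inner) ∩ F) :=
            (measure_iUnion hdisj fun s =>
              ((R s.1).measurableSet_inner.const_vadd s.2).inter
                (ZSpan.fundamentalDomain_measurableSet e)).symm
        _ ≤ volume F := measure_mono (Set.iUnion_subset fun s => Set.inter_subset_right)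
  rw [ZLattice.covolume_eq_measure_fundamentalDomain Λ volume hF, measureReal_def, hvol,
    ENNReal.toReal_ofReal (Finset.sum_nonneg fun i _ => harea i)]

end Covolume

/-! ### Tilings with a tile that closes up around the torus -/

theorem PlaneTiling.width_le {Λ : Submodule ℤ (ℝ × ℝ)} {ι : Type*} {R : ι → Rect}
    (h : PlaneTiling Λ R) (i : ι) {t : ℝ} (ht : 0 < t) (hΛ : (t, (0 : ℝ)) ∈ Λ) :
    (R i).b - (R i).a ≤ t := by
  by_contra! hlt
  obtain ⟨x, hx1, hx2⟩ := exists_between (show (R i).a < (R i).b - t by linarith)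
  obtain ⟨y, hy1, hy2⟩ := exists_between (R i).hcd
  obtain ⟨-, h0⟩ := h.unique i i (t, 0) hΛ (x, y) ⟨⟨hx1, by simp; linarith⟩, hy1, hy2⟩
    ⟨⟨by simp; linarith, by simp; linarith⟩, by simpa using hy1, by simpa using hy2⟩
  rw [Prod.mk_eq_zero] at h0
  exact ht.ne' h0.1

theorem PlaneTiling.dx_eq {Λ : Submodule ℤ (ℝ × ℝ)} {ι : Type*} {R : ι → Rect}
    (h : PlaneTiling Λ R) {i : ι} (hi : ((R i).b - (R i).a, 0) ∈ Λ) :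
    dx Λ = (R i).b - (R i).a :=
  IsLeast.csInf_eq ⟨⟨sub_pos.2 (R i).hab, hi⟩, fun _ ht => h.width_le i ht.1 ht.2⟩

/-- A tile that closes up horizontally has width `dx Λ`, which is the largest width of all tiles.
The area of the torus therefore bounds the total height of the tiles from below. -/
theorem PlaneTiling.mx_le {Λ : Submodule ℤ (ℝ × ℝ)} (hΛ : IsPlaneLattice Λ) {ι : Type*}
    [Fintype ι] {R : ι → Rect} (h : PlaneTiling Λ R) {i : ι}
    (hi : ((R i).b - (R i).a, 0) ∈ Λ) : mx Λ ≤ totalLength R := by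
  have hpos := sub_pos.2 (R i).hab
  rw [mx, if_pos ⟨_, hpos.ne', hi⟩, EReal.coe_le_coe_iff, h.dx_eq hi, totalLength,
    Finset.sum_add_distrib, h.covolume_eq hΛ]
  refine add_le_add ?_ ((div_le_iff₀' hpos).2 ?_)
  · exact Finset.single_le_sum (f := fun i => (R i).b - (R i).a)
      (fun i _ => (sub_pos.2 (R i).hab).le) (Finset.mem_univ i)
  · rw [Finset.mul_sum]
    exact Finset.sum_le_sum fun j _ =>
      mul_le_mul_of_nonneg_right (h.width_le j hpos hi) (sub_pos.2 (R j).hcd).le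

/-- The rectangle with one corner at the origin and the opposite one at `(D, y)`. -/
def cornerRect {D y : ℝ} (hD : 0 < D) (hy : 0 < y) : Rect := ⟨0, D, 0, y, hD, hy⟩

/-- If `(D, 0)` and `(x, y)` generate the lattice, the rectangle `[0, D] × [0, y]` tiles the torus:
its translates form horizontal strips, shifted against each other by `x`. -/
theorem planeTiling_cornerRect {Λ : Submodule ℤ (ℝ × ℝ)} {D x y : ℝ} (hD : 0 < D) (hy : 0 < y)
    (h1 : (D, 0) ∈ Λ) (h2 : (x, y) ∈ Λ)
    (hgen : ∀ l ∈ Λ, ∃ m n : ℤ, l = (m * D + n * x, n * y)) :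
    PlaneTiling Λ fun _ : Unit => cornerRect hD hy where
  unique i j l hl z hz hz' := by
    refine ⟨rfl, ?_⟩
    obtain ⟨m, n, rfl⟩ := hgen l hl
    obtain ⟨⟨a1, a2⟩, a3, a4⟩ := hz
    obtain ⟨⟨b1, b2⟩, b3, b4⟩ := hz'
    simp only [cornerRect, Prod.fst_add, Prod.snd_add] at a1 a2 a3 a4 b1 b2 b3 b4
    have small : ∀ {k : ℤ} {t : ℝ}, 0 < t → -t < k * t → k * t < t → k = 0 := by
      intro k t ht h1 h2
      have h3 : (-1 : ℝ) < k := by nlinarith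
      have h4 : (k : ℝ) < 1 := by nlinarith
      have h5 : -1 < k := by exact_mod_cast h3
      have h6 : k < 1 := by exact_mod_cast h4
      omega
    have hn : n = 0 := small hy (by linarith) (by linarith)
    subst hn
    have hm : m = 0 := small hD (by push_cast at b1; linarith) (by push_cast at b2; linarith)
    simp [hm]
  cover z := by
    have key : ∀ {t : ℝ}, 0 < t → ∀ a : ℝ, 0 ≤ a - ⌊a / t⌋ * t ∧ a - ⌊a / t⌋ * t ≤ t := by
      intro t ht a
      have h1 := (le_div_iff₀ ht).1 (Int.floor_le (a / t))
      have h2 := (div_lt_iff₀ ht).1 (Int.lt_floor_add_one (a / t))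
      constructor <;> linarith
    set n := ⌊z.2 / y⌋ with hn
    set m := ⌊(z.1 - n * x) / D⌋ with hm
    refine ⟨(), -(m • (D, 0) + n • (x, y)),
      Λ.neg_mem (Λ.add_mem (Λ.smul_mem m h1) (Λ.smul_mem n h2)), ?_⟩
    obtain ⟨e1, e2⟩ := key hy z.2
    obtain ⟨e3, e4⟩ := key hD (z.1 - n * x)
    rw [← hn] at e1 e2
    rw [← hm] at e3 e4
    have hz1 : (z + -(m • (D, 0) + n • (x, y))).1 = z.1 - n * x - m * D := by simp; ring
    have hz2 : (z + -(m • (D, 0) + n • (x, y))).2 = z.2 - n * y := by simp; ring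
    simp only [Rect.closed, cornerRect, Set.mem_prod, Set.mem_Icc, hz1, hz2]
    exact ⟨⟨by linarith, by linarith⟩, by linarith, by linarith⟩

/-- A shortest horizontal lattice vector `(D, 0)` and a lattice vector at the smallest positive
height generate the lattice, and the rectangle spanned by this length and this height tiles. -/
theorem exists_planeTiling_mx {Λ : Submodule ℤ (ℝ × ℝ)} (hΛ : IsPlaneLattice Λ)
    (hx : ∃ a : ℝ, a ≠ 0 ∧ (a, (0 : ℝ)) ∈ Λ) :
    ∃ R : Unit → Rect, PlaneTiling Λ R ∧ mx Λ = totalLength R := by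
  have hfin := hΛ.locallyFinite
  have hx' : {l : ℝ × ℝ | l ∈ Λ ∧ l.2 = 0 ∧ 0 < l.1}.Nonempty := by
    obtain ⟨a, ha, haΛ⟩ := hx
    rcases lt_or_gt_of_ne ha with ha | ha
    · exact ⟨(-a, 0), by simpa using Λ.neg_mem haΛ, rfl, neg_pos.2 ha⟩
    · exact ⟨(a, 0), haΛ, rfl, ha⟩
  obtain ⟨⟨D, _⟩, ⟨h1, rfl, hD⟩, hDmin⟩ := hfin.exists_min (fun l hl => hl.1) hx' (fun l => l.1)
    (fun B => ⟨max B 0, fun l hl h => by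
      rw [hl.2.1, abs_zero, abs_of_pos hl.2.2]
      exact ⟨le_max_of_le_left h, le_max_right _ _⟩⟩)
  simp only at hD hDmin
  -- a lattice vector can be translated into the strip `0 ≤ x ≤ D`
  have hred : ∀ l ∈ Λ, ∃ m : ℤ, (l.1 - m * D, l.2) ∈ Λ ∧ 0 ≤ l.1 - m * D ∧ l.1 - m * D < D := by
    intro l hl
    have e1 := (le_div_iff₀ hD).1 (Int.floor_le (l.1 / D))
    have e2 := (div_lt_iff₀ hD).1 (Int.lt_floor_add_one (l.1 / D))
    refine ⟨⌊l.1 / D⌋, ?_, by linarith, by linarith⟩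
    convert Λ.sub_mem hl (Λ.smul_mem ⌊l.1 / D⌋ h1) using 1
    ext <;> simp
  have hy' : {l : ℝ × ℝ | l ∈ Λ ∧ 0 < l.2 ∧ 0 ≤ l.1 ∧ l.1 ≤ D}.Nonempty := by
    obtain ⟨C, hC⟩ := hΛ.exists_near
    obtain ⟨l, hl, -, hl2⟩ := hC (0, C + 1)
    have hl3 := (abs_le.1 hl2).2
    simp only at hl3
    obtain ⟨m, hm, hm1, hm2⟩ := hred l hl
    exact ⟨_, hm, by simp only; linarith, hm1, hm2.le⟩
  obtain ⟨⟨x, y⟩, ⟨h2, hy, -, -⟩, hymin⟩ := hfin.exists_min (fun l hl => hl.1) hy' (fun l => l.2)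
    (fun B => ⟨max B D, fun l hl h => by
      rw [abs_of_pos hl.2.1, abs_of_nonneg hl.2.2.1]
      exact ⟨le_max_of_le_right hl.2.2.2, le_max_of_le_left h⟩⟩)
  simp only at hy hymin
  have hgen : ∀ l ∈ Λ, ∃ m n : ℤ, l = (m * D + n * x, n * y) := by
    intro l hl
    have e1 := (le_div_iff₀ hy).1 (Int.floor_le (l.2 / y))
    have e2 := (div_lt_iff₀ hy).1 (Int.lt_floor_add_one (l.2 / y))
    set n := ⌊l.2 / y⌋
    have hl' : (l.1 - n * x, l.2 - n * y) ∈ Λ := by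
      convert Λ.sub_mem hl (Λ.smul_mem n h2) using 1
      ext <;> simp
    obtain ⟨m, hm, hm1, hm2⟩ := hred _ hl'
    simp only at hm hm1 hm2
    have e3 : l.2 - n * y = 0 := by
      by_contra hne
      have hpos : 0 < l.2 - n * y := lt_of_le_of_ne (by linarith) (Ne.symm hne)
      have := hymin _ ⟨hm, hpos, hm1, hm2.le⟩
      simp only at this
      linarith
    rw [e3] at hm
    have e4 : l.1 - n * x - m * D = 0 := by
      by_contra hne
      have hpos : 0 < l.1 - n * x - m * D := lt_of_le_of_ne hm1 (Ne.symm hne)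
      have := hDmin _ ⟨hm, rfl, hpos⟩
      simp only at this
      linarith
    exact ⟨m, n, Prod.ext (by simp only; linarith) (by simp only; linarith)⟩
  have hT := planeTiling_cornerRect hD hy h1 h2 hgen
  have hdx : dx Λ = D := by
    rw [hT.dx_eq (i := ()) (by simpa [cornerRect] using h1)]
    simp [cornerRect]
  refine ⟨_, hT, ?_⟩
  rw [mx, if_pos hx, hdx, hT.covolume_eq hΛ, totalLength]
  simp only [cornerRect, Finset.univ_unique, Finset.sum_singleton, sub_zero]
  rw [mul_div_cancel_left₀ _ hD.ne']

/-- The rotation `(x, y) ↦ (-y, x)` as a linear automorphism of the plane. -/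
def rotLinearEquiv : (ℝ × ℝ) ≃ₗ[ℝ] (ℝ × ℝ) where
  toFun p := (-p.2, p.1)
  invFun p := (p.2, -p.1)
  map_add' p q := by simp [add_comm]
  map_smul' c p := by simp
  left_inv p := by simp
  right_inv p := by simp

theorem IsPlaneLattice.rot {Λ : Submodule ℤ (ℝ × ℝ)} (hΛ : IsPlaneLattice Λ) :
    IsPlaneLattice (rotLattice Λ) := by
  obtain ⟨e, rfl⟩ := hΛ
  refine ⟨e.map rotLinearEquiv, ?_⟩
  rw [← ZSpan.map]
  ext l
  rw [Submodule.mem_map]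
  refine ⟨fun h => ⟨_, mem_rotLattice.1 h, by simp [rotLinearEquiv]⟩, ?_⟩
  rintro ⟨m, hm, rfl⟩
  exact rot_mem_rotLattice hm

theorem totalArea_rotFamily {ι : Type*} [Fintype ι] (R : ι → Rect) :
    ∑ i, ((rotFamily R i).b - (rotFamily R i).a) * ((rotFamily R i).d - (rotFamily R i).c) =
      ∑ i, ((R i).b - (R i).a) * ((R i).d - (R i).c) := by
  refine Finset.sum_congr rfl fun i _ => ?_
  simp only [rotFamily, Rect.rot]
  ring

theorem PlaneTiling.of_rot {Λ : Submodule ℤ (ℝ × ℝ)} {ι : Type*} {R : ι → Rect}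
    (h : PlaneTiling (rotLattice Λ) R) : PlaneTiling Λ (rotFamily (rotFamily (rotFamily R))) := by
  have := h.rot.rot.rot
  rwa [rotLattice_four] at this

theorem dx_rotLattice (Λ : Submodule ℤ (ℝ × ℝ)) : dx (rotLattice Λ) = dy Λ := by
  unfold dx dy
  congr 1
  ext t
  refine and_congr_right fun _ => ?_
  rw [mem_rotLattice, ← Λ.neg_mem_iff]
  simp

theorem mx_rotLattice {Λ : Submodule ℤ (ℝ × ℝ)} (hΛ : IsPlaneLattice Λ) :
    mx (rotLattice Λ) = my Λ := by
  have hiff : (∃ a : ℝ, a ≠ 0 ∧ (a, (0 : ℝ)) ∈ rotLattice Λ) ↔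
      ∃ b : ℝ, b ≠ 0 ∧ ((0 : ℝ), b) ∈ Λ := by
    refine exists_congr fun t => and_congr_right fun _ => ?_
    rw [mem_rotLattice, ← Λ.neg_mem_iff]
    simp
  by_cases h : ∃ a : ℝ, a ≠ 0 ∧ (a, (0 : ℝ)) ∈ rotLattice Λ
  · obtain ⟨R, hR, -⟩ := exists_planeTiling_mx hΛ.rot h
    rw [mx, my, if_pos h, if_pos (hiff.1 h), dx_rotLattice, hR.covolume_eq hΛ.rot,
      hR.of_rot.covolume_eq hΛ, totalArea_rotFamily, totalArea_rotFamily, totalArea_rotFamily]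
  · rw [mx, my, if_neg h, if_neg (mt hiff.2 h)]

theorem PlaneTiling.my_le {Λ : Submodule ℤ (ℝ × ℝ)} (hΛ : IsPlaneLattice Λ) {ι : Type*}
    [Fintype ι] {R : ι → Rect} (h : PlaneTiling Λ R) {i : ι}
    (hi : (0, (R i).d - (R i).c) ∈ Λ) : my Λ ≤ totalLength R := by
  rw [← mx_rotLattice hΛ, ← totalLength_rotFamily]
  refine h.rot.mx_le hΛ.rot (i := i) ?_
  rw [mem_rotLattice, ← Λ.neg_mem_iff]
  simpa [rotFamily, Rect.rot, ← sub_eq_neg_add] using hi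

/-! ### The tiling by two rectangles -/

/-- The lower one of two rectangles forming an L-shape, of size `r × q`, or the upper one, of size
`p × s`. The L-shape is a fundamental domain of the lattice generated by `(p, q)` and `(-r, s)`. -/
def lShape {p q r s : ℝ} (hp : 0 < p) (hq : 0 < q) (hr : 0 < r) (hs : 0 < s) : Bool → Rect
  | false => ⟨0, r, 0, q, hr, hq⟩
  | true => ⟨0, p, q, q + s, hp, by linarith⟩

/-- The upper rectangle does not overlap with its translates by nonzero lattice vectors. Exchanging
`(p, q)` with `(r, s)` and `m` with `n` yields the same for the lower rectangle. -/
theorem eq_zero_of_abs_lt {p q r s : ℝ} (hp : 0 < p) (hq : 0 < q) (hr : 0 < r) (hs : 0 < s)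
    {m n : ℤ} (h1 : |m * p - n * r| < p) (h2 : |m * q + n * s| < s) : m = 0 ∧ n = 0 := by
  rw [abs_lt] at h1 h2
  obtain ⟨h1, h1'⟩ := h1
  obtain ⟨h2, h2'⟩ := h2
  have cast_pos : ∀ {k : ℤ}, 0 < k → (1 : ℝ) ≤ k := fun h => by exact_mod_cast h
  have cast_neg : ∀ {k : ℤ}, k < 0 → (k : ℝ) ≤ -1 := fun {k} h => by
    have : k ≤ -1 := by omega
    exact_mod_cast this
  rcases lt_trichotomy m 0 with hm | rfl | hm
  · have hm' := mul_le_mul_of_nonneg_right (cast_neg hm) hp.le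
    have hm'' := mul_le_mul_of_nonneg_right (cast_neg hm) hq.le
    rcases lt_or_ge n 0 with hn | hn
    · have hn' := mul_le_mul_of_nonneg_right (cast_neg hn) hs.le
      linarith
    · have hn' : (0 : ℝ) ≤ n * r := mul_nonneg (by exact_mod_cast hn) hr.le
      linarith
  · refine ⟨rfl, ?_⟩
    rcases lt_trichotomy n 0 with hn | rfl | hn
    · have hn' := mul_le_mul_of_nonneg_right (cast_neg hn) hs.le
      simp only [Int.cast_zero, zero_mul] at h2
      linarith
    · rfl
    · have hn' := mul_le_mul_of_nonneg_right (cast_pos hn) hs.le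
      simp only [Int.cast_zero, zero_mul] at h2'
      linarith
  · have hm' := mul_le_mul_of_nonneg_right (cast_pos hm) hp.le
    have hm'' := mul_le_mul_of_nonneg_right (cast_pos hm) hq.le
    rcases lt_or_ge 0 n with hn | hn
    · have hn' := mul_le_mul_of_nonneg_right (cast_pos hn) hs.le
      linarith
    · have hn' : n * r ≤ 0 := mul_nonpos_of_nonpos_of_nonneg (by exact_mod_cast hn) hr.le
      linarith

/-- No translate of the lower rectangle overlaps with the upper one. -/
theorem not_lower_meets_upper {p q r s : ℝ} (hp : 0 < p) (hq : 0 < q) (hr : 0 < r) (hs : 0 < s)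
    {m n : ℤ} (h1 : -r < m * p - n * r) (h2 : m * p - n * r < p) (h3 : 0 < m * q + n * s)
    (h4 : m * q + n * s < q + s) : False := by
  rcases le_or_gt m 0 with hm | hm
  · have hm0 : (m : ℝ) ≤ 0 := by exact_mod_cast hm
    have hm' := mul_nonpos_of_nonpos_of_nonneg hm0 hp.le
    have hm'' := mul_nonpos_of_nonpos_of_nonneg hm0 hq.le
    rcases le_or_gt n 0 with hn | hn
    · have hn0 : (n : ℝ) ≤ 0 := by exact_mod_cast hn
      linarith [mul_nonpos_of_nonpos_of_nonneg hn0 hs.le]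
    · have hn1 : (1 : ℝ) ≤ n := by exact_mod_cast hn
      linarith [mul_le_mul_of_nonneg_right hn1 hr.le]
  · have hm1 : (1 : ℝ) ≤ m := by exact_mod_cast hm
    have hm' := mul_le_mul_of_nonneg_right hm1 hp.le
    have hm'' := mul_le_mul_of_nonneg_right hm1 hq.le
    rcases le_or_gt n 0 with hn | hn
    · have hn0 : (n : ℝ) ≤ 0 := by exact_mod_cast hn
      linarith [mul_nonpos_of_nonpos_of_nonneg hn0 hr.le]
    · have hn1 : (1 : ℝ) ≤ n := by exact_mod_cast hn
      linarith [mul_le_mul_of_nonneg_right hn1 hs.le]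

/-- The translates of the L-shape cover the plane. -/
theorem exists_translate_mem_lShape {p q r s : ℝ} (hp : 0 < p) (hq : 0 < q) (hr : 0 < r)
    (hs : 0 < s) (x y : ℝ) : ∃ i : Bool, ∃ m n : ℤ,
      (x - (m * p - n * r), y - (m * q + n * s)) ∈ (lShape hp hq hr hs i).closed := by
  -- subtract `(p, q)` as often as the closed first quadrant can still be reached along `(-r, s)`
  have hbdd : ∃ b : ℤ, ∀ m : ℤ,
      (∃ n : ℤ, 0 ≤ x - (m * p - n * r) ∧ 0 ≤ y - (m * q + n * s)) → m ≤ b := by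
    have hdet : 0 < s * p + r * q := add_pos (mul_pos hs hp) (mul_pos hr hq)
    refine ⟨⌊(s * x + r * y) / (s * p + r * q)⌋, fun m ⟨n, h1, h2⟩ => Int.le_floor.2 ?_⟩
    rw [le_div_iff₀ hdet]
    linarith [mul_nonneg hs.le h1, mul_nonneg hr.le h2]
  have hne : ∃ m : ℤ, ∃ n : ℤ, 0 ≤ x - (m * p - n * r) ∧ 0 ≤ y - (m * q + n * s) := by
    refine ⟨min ⌊x / p⌋ ⌊y / q⌋, 0, ?_, ?_⟩
    · have h1 := (le_div_iff₀ hp).1 (Int.floor_le (x / p))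
      have h2 : ((min ⌊x / p⌋ ⌊y / q⌋ : ℤ) : ℝ) ≤ ⌊x / p⌋ := by exact_mod_cast min_le_left _ _
      have h3 := mul_le_mul_of_nonneg_right h2 hp.le
      rw [Int.cast_zero, zero_mul]
      linarith
    · have h1 := (le_div_iff₀ hq).1 (Int.floor_le (y / q))
      have h2 : ((min ⌊x / p⌋ ⌊y / q⌋ : ℤ) : ℝ) ≤ ⌊y / q⌋ := by exact_mod_cast min_le_right _ _
      have h3 := mul_le_mul_of_nonneg_right h2 hq.le
      rw [Int.cast_zero, zero_mul]
      linarith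
  obtain ⟨m, ⟨n, hx, hy⟩, hmax⟩ := Int.exists_greatest_of_bdd hbdd hne
  have hmax' : ∀ n : ℤ, 0 ≤ x - (m * p - n * r) - p → 0 ≤ y - (m * q + n * s) - q → False := by
    intro n h1 h2
    have := hmax (m + 1) ⟨n, by push_cast; linarith, by push_cast; linarith⟩
    omega
  set X := x - (m * p - n * r) with hX
  set Y := y - (m * q + n * s) with hY
  -- move along `(-r, s)` to the height of the upper rectangle
  have e1 := (le_div_iff₀ hs).1 (Int.floor_le ((Y - q) / s))
  have e2 := (div_lt_iff₀ hs).1 (Int.lt_floor_add_one ((Y - q) / s))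
  set k := ⌊(Y - q) / s⌋
  rcases le_or_gt 0 (X + k * r) with hXk | hXk
  · refine ⟨true, m, n + k, ?_⟩
    have h1 : X + k * r < p := by
      by_contra! hle
      refine hmax' (n + k) ?_ ?_ <;> push_cast <;> linarith
    simp only [Rect.closed, lShape, Set.mem_prod, Set.mem_Icc]
    push_cast
    exact ⟨⟨by linarith, by linarith⟩, by linarith, by linarith⟩
  · -- the point is left of the upper rectangle; move back to the lower one
    have e3 := (le_div_iff₀ hr).1 (Int.floor_le (X / r))
    have e4 := (div_lt_iff₀ hr).1 (Int.lt_floor_add_one (X / r))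
    have hj : 0 ≤ ⌊X / r⌋ := Int.floor_nonneg.2 (div_nonneg hx hr.le)
    set j := ⌊X / r⌋
    have hjk : k + 1 ≤ -j := by
      by_contra! hlt
      have : -j ≤ k := by omega
      have : (-j : ℝ) ≤ k := by exact_mod_cast this
      have := mul_le_mul_of_nonneg_right this hr.le
      linarith
    have hjk' : (k + 1 : ℝ) ≤ -j := by exact_mod_cast hjk
    have hjk'' := mul_le_mul_of_nonneg_right hjk' hs.le
    have hj' : (0 : ℝ) ≤ j * s := mul_nonneg (by exact_mod_cast hj) hs.le
    refine ⟨false, m, n - j, ?_⟩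
    simp only [Rect.closed, lShape, Set.mem_prod, Set.mem_Icc]
    push_cast
    exact ⟨⟨by linarith, by linarith⟩, by linarith, by linarith⟩

theorem planeTiling_lShape {Λ : Submodule ℤ (ℝ × ℝ)} {p q r s : ℝ} (hp : 0 < p) (hq : 0 < q)
    (hr : 0 < r) (hs : 0 < s) (hu : (p, q) ∈ Λ) (hv : (-r, s) ∈ Λ)
    (hgen : ∀ x y : ℝ, (x, y) ∈ Λ → ∃ m n : ℤ, x = m * p - n * r ∧ y = m * q + n * s) :
    PlaneTiling Λ (lShape hp hq hr hs) where
  unique i j l hl z hz hz' := by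
    obtain ⟨x, y⟩ := l
    obtain ⟨m, n, rfl, rfl⟩ := hgen x y hl
    obtain ⟨⟨a1, a2⟩, a3, a4⟩ := hz
    obtain ⟨⟨b1, b2⟩, b3, b4⟩ := hz'
    have hzero : m = 0 ∧ n = 0 → ((m * p - n * r, m * q + n * s) : ℝ × ℝ) = 0 := by
      rintro ⟨rfl, rfl⟩
      simp
    cases i <;> cases j <;>
      simp only [lShape, Prod.fst_add, Prod.snd_add] at a1 a2 a3 a4 b1 b2 b3 b4
    · refine ⟨rfl, hzero (And.symm ?_)⟩
      refine eq_zero_of_abs_lt hr hs hp hq (abs_lt.2 ⟨?_, ?_⟩) (abs_lt.2 ⟨?_, ?_⟩) <;> linarith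
    · exact (not_lower_meets_upper hp hq hr hs (m := m) (n := n) (by linarith) (by linarith)
        (by linarith) (by linarith)).elim
    · exact (not_lower_meets_upper hp hq hr hs (m := -m) (n := -n) (by push_cast; linarith)
        (by push_cast; linarith) (by push_cast; linarith) (by push_cast; linarith)).elim
    · refine ⟨rfl, hzero ?_⟩
      refine eq_zero_of_abs_lt hp hq hr hs (abs_lt.2 ⟨?_, ?_⟩) (abs_lt.2 ⟨?_, ?_⟩) <;> linarith
  cover z := by
    obtain ⟨i, m, n, h⟩ := exists_translate_mem_lShape hp hq hr hs z.1 z.2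
    refine ⟨i, -(m • (p, q) + n • (-r, s)),
      Λ.neg_mem (Λ.add_mem (Λ.smul_mem m hu) (Λ.smul_mem n hv)), ?_⟩
    convert h using 1
    ext <;> simp <;> ring

/-! ### Tilings of the torus and of the plane -/

theorem RectTiling.planeTiling {Λ : Submodule ℤ (ℝ × ℝ)} (T : RectTiling Λ) :
    PlaneTiling Λ T.rect where
  unique i j l hl z hz hz' := by
    have hproj : proj Λ (z + l) = proj Λ z := by
      simpa [proj] using (Submodule.Quotient.mk_eq_zero Λ).2 hl
    have hij : i = j := by
      by_contra hne
      exact Set.disjoint_left.1 (T.disjoint i j hne) ⟨z, hz, rfl⟩ ⟨z + l, hz', hproj⟩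
    subst hij
    exact ⟨rfl, by simpa using T.injOn i hz' hz hproj⟩
  cover z := by
    have hz : proj Λ z ∈ ⋃ i, proj Λ '' (T.rect i).closed := by
      rw [T.cover]
      trivial
    obtain ⟨i, w, hw, hwz⟩ := Set.mem_iUnion.1 hz
    exact ⟨i, w - z, (Submodule.Quotient.eq Λ).1 hwz, by simpa using hw⟩

theorem RectTiling.length_eq {Λ : Submodule ℤ (ℝ × ℝ)} (T : RectTiling Λ) :
    T.length = totalLength T.rect := by
  rw [RectTiling.length, totalLength, div_eq_iff two_ne_zero, Finset.sum_mul]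
  exact Finset.sum_congr rfl fun i _ => mul_comm _ _

theorem PlaneTiling.exists_rectTiling {Λ : Submodule ℤ (ℝ × ℝ)} {ι : Type*} [Fintype ι]
    {R : ι → Rect} (h : PlaneTiling Λ R) :
    ∃ T : RectTiling Λ, T.k = Fintype.card ι ∧ T.length = totalLength R := by
  let e := (Fintype.equivFin ι).symm
  have hmem : ∀ {z w : ℝ × ℝ}, proj Λ z = proj Λ w → w - z ∈ Λ := fun hzw =>
    (Submodule.Quotient.eq Λ).1 hzw.symm
  refine ⟨⟨Fintype.card ι, R ∘ e, ?_, ?_, ?_⟩, rfl, ?_⟩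
  · intro i z hz w hw hzw
    have := (h.unique (e i) (e i) _ (hmem hzw) z hz (by simpa using hw)).2
    exact (sub_eq_zero.1 this).symm
  · intro i j hij
    rw [Set.disjoint_left]
    rintro _ ⟨z, hz, rfl⟩ ⟨w, hw, hwz⟩
    exact hij (e.injective (h.unique (e i) (e j) _ (hmem hwz.symm) z hz (by simpa using hw)).1)
  · refine Set.eq_univ_of_forall fun t => ?_
    obtain ⟨z, rfl⟩ := Λ.mkQ_surjective t
    obtain ⟨i, l, hl, hz⟩ := h.cover z
    refine Set.mem_iUnion.2 ⟨e.symm i, z + l, by simpa using hz, ?_⟩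
    simpa [proj] using (Submodule.Quotient.mk_eq_zero Λ).2 hl
  · rw [RectTiling.length_eq, totalLength, totalLength]
    exact e.sum_comp fun i => ((R i).b - (R i).a) + ((R i).d - (R i).c)

/-! ### The minimal length -/

theorem IsQuadrantBasis.le_length {Λ : Submodule ℤ (ℝ × ℝ)} (hΛ : IsPlaneLattice Λ)
    {u v : ℝ × ℝ} (h : IsQuadrantBasis Λ u v) (T : RectTiling Λ) :
    min ((l1norm u + l1norm v : ℝ) : EReal) (min (mx Λ) (my Λ)) ≤ (T.length : EReal) := by
  rw [T.length_eq]
  refine PlaneTiling.le_totalLength hΛ.locallyFinite ?_ ?_ ?_ _ _ T.planeTiling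
  · intro ι _ R hR i hi
    exact ((min_le_right _ _).trans (min_le_left _ _)).trans (hR.mx_le hΛ hi)
  · intro ι _ R hR i hi
    exact ((min_le_right _ _).trans (min_le_right _ _)).trans (hR.my_le hΛ hi)
  · intro l hl m hm h1 h2
    refine (min_le_left _ _).trans (EReal.coe_le_coe_iff.2 (add_le_add ?_ ?_))
    · refine h.u_min l ⟨⟨hl, h1.le⟩, ?_⟩
      rintro rfl
      simp at h1
    · exact h.v_min m ⟨hm, h2⟩

/-- If the first vector of a quadrant basis is horizontal, a single rectangle gives a shorter tiling
than the quadrant basis would. -/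
theorem mx_le_of_horizontal {Λ : Submodule ℤ (ℝ × ℝ)} (hΛ : IsPlaneLattice Λ) {p x s : ℝ}
    (hp : 0 < p) (hs : 0 < s) (hu : (p, 0) ∈ Λ) (hv : (x, s) ∈ Λ)
    (hgen : ∀ l ∈ Λ, ∃ m n : ℤ, l = (m * p + n * x, n * s)) : mx Λ ≤ ((p + s : ℝ) : EReal) := by
  have := (planeTiling_cornerRect hp hs hu hv hgen).mx_le hΛ (i := ())
    (by simpa [cornerRect] using hu)
  simpa [totalLength, cornerRect] using this

theorem IsQuadrantBasis.exists_rectTiling {Λ : Submodule ℤ (ℝ × ℝ)} (hΛ : IsPlaneLattice Λ)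
    {u v : ℝ × ℝ} (h : IsQuadrantBasis Λ u v) :
    ∃ T : RectTiling Λ, (T.k = 1 ∨ T.k = 2) ∧ (T.length : EReal) =
      min ((l1norm u + l1norm v : ℝ) : EReal) (min (mx Λ) (my Λ)) := by
  have hone : ∀ {Λ' : Submodule ℤ (ℝ × ℝ)}, IsPlaneLattice Λ' → mx Λ' ≠ ⊤ →
      ∃ R : Unit → Rect, PlaneTiling Λ' R ∧ mx Λ' = totalLength R := by
    intro Λ' hΛ' hne
    have hx : ∃ a : ℝ, a ≠ 0 ∧ (a, (0 : ℝ)) ∈ Λ' := by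
      by_contra hx
      exact hne (if_neg hx)
    obtain ⟨R, hR, hm⟩ := exists_planeTiling_mx hΛ' hx
    exact ⟨R, hR, hm⟩
  rcases le_or_gt (min (mx Λ) (my Λ)) ((l1norm u + l1norm v : ℝ) : EReal) with hle | hlt
  · rw [min_eq_right hle]
    have hne : min (mx Λ) (my Λ) ≠ ⊤ := ne_top_of_le_ne_top (EReal.coe_ne_top _) hle
    rcases min_choice (mx Λ) (my Λ) with hm | hm
    · rw [hm] at hne ⊢
      obtain ⟨R, hR, hlen⟩ := hone hΛ hne
      obtain ⟨T, hk, hT⟩ := hR.exists_rectTiling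
      exact ⟨T, Or.inl hk, by rw [hT, hlen]⟩
    · rw [hm, ← mx_rotLattice hΛ] at hne ⊢
      obtain ⟨R, hR, hlen⟩ := hone hΛ.rot hne
      obtain ⟨T, hk, hT⟩ := hR.of_rot.exists_rectTiling
      refine ⟨T, Or.inl hk, ?_⟩
      rw [hT, hlen, totalLength_rotFamily, totalLength_rotFamily, totalLength_rotFamily]
  · rw [min_eq_left hlt.le]
    obtain ⟨hltx, hlty⟩ := lt_min_iff.1 hlt
    obtain ⟨p, q, r, s, h', hp, hq, hpq, hr, hs, hu, hv⟩ := h.exists_normalized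
    rw [hu, hv] at hltx hlty ⊢
    have huΛ := h'.u_mem.1.1
    have hvΛ := h'.v_mem.1
    have hgen : ∀ x y : ℝ, (x, y) ∈ Λ → ∃ m n : ℤ, x = m * p - n * r ∧ y = m * q + n * s :=
      fun x y => h'.exists_int hp hq hpq hr hs
    have hq0 : 0 < q := by
      refine hq.lt_of_ne fun hq0 => ?_
      subst hq0
      have := hltx.trans_le (mx_le_of_horizontal hΛ (by linarith) hs huΛ hvΛ fun l hl => by
        obtain ⟨m, n, h1, h2⟩ := hgen l.1 l.2 hl
        exact ⟨m, n, Prod.ext (by simp only; linarith) (by simp only; linarith)⟩)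
      rw [EReal.coe_lt_coe_iff] at this
      linarith
    have hp0 : 0 < p := by
      refine hp.lt_of_ne fun hp0 => ?_
      subst hp0
      rw [← mx_rotLattice hΛ] at hlty
      have := hlty.trans_le (mx_le_of_horizontal hΛ.rot hq0 hr (x := s)
        (by simpa [mem_rotLattice] using Λ.neg_mem huΛ)
        (by simpa [mem_rotLattice] using Λ.neg_mem hvΛ) fun l hl => by
          obtain ⟨m, n, h1, h2⟩ := hgen _ _ (mem_rotLattice.1 hl)
          refine ⟨-m, -n, Prod.ext ?_ ?_⟩ <;> simp only <;> push_cast <;> linarith)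
      rw [EReal.coe_lt_coe_iff] at this
      linarith
    obtain ⟨T, hk, hT⟩ := (planeTiling_lShape hp0 hq0 hr hs huΛ hvΛ hgen).exists_rectTiling
    refine ⟨T, Or.inr hk, ?_⟩
    rw [hT]
    simp only [totalLength, lShape, Fintype.sum_bool]
    rw [EReal.coe_eq_coe_iff]
    ring

end FlatTorus

theorem theorem4p1 (Λ : Submodule ℤ (ℝ × ℝ)) (hΛ : FlatTorus.IsPlaneLattice Λ) :
    (∃ u v : ℝ × ℝ, FlatTorus.IsQuadrantBasis Λ u v) ∧
    ∀ u v : ℝ × ℝ, FlatTorus.IsQuadrantBasis Λ u v →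
      IsLeast (Set.range fun T : FlatTorus.RectTiling Λ => (T.length : EReal))
        (min ((FlatTorus.l1norm u + FlatTorus.l1norm v : ℝ) : EReal)
          (min (FlatTorus.mx Λ) (FlatTorus.my Λ))) ∧
      ∃ T : FlatTorus.RectTiling Λ, (T.k = 1 ∨ T.k = 2) ∧
        (T.length : EReal) =
          min ((FlatTorus.l1norm u + FlatTorus.l1norm v : ℝ) : EReal)
            (min (FlatTorus.mx Λ) (FlatTorus.my Λ)) := by
  refine ⟨FlatTorus.exists_isQuadrantBasis hΛ, fun u v h => ?_⟩
  obtain ⟨T, hk, hT⟩ := h.exists_rectTiling hΛ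
  refine ⟨⟨⟨T, hT⟩, ?_⟩, T, hk, hT⟩
  rintro _ ⟨T', rfl⟩
  exact h.le_length hΛ T'
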